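/- Let $\mathbb D$ be the open unit disk. A Nehari function is a positive continuous even function $p$ on $(-1,1)$ such that $(1-x^2)^2p(x)$ is nonincreasing on $[0,1)$ and no nontrivial solution $u$ of $u''+pu=0$ has more than one zero in $(-1,1)$; it is extremal if $cp$ is not a Nehari function for any constant $c>1$. Given a Nehari function $p$, let $u_0$ be the solution of $u''+pu=0$ on $(-1,1)$ with $u_0(0)=1$, $u_0'(0)=0$, and put $F(x)=\int_0^x u_0(t)^{-2}\,dt$ for $-1<x<1$. Let $f=h+\overline g$ be a harmonic mapping of $\mathbb D$, where $h,g$ are analytic in $\mathbb D$ and $g(0)=0$. Suppose that $\lambda(z)=|h'(z)|+|g'(z)|\neq0$ for all $z\in\mathbb D$ and that the dilatation satisfies $g'/h'=q^2$ for some meromorphic function $q$ on $\mathbb D$ (in particular $h'\not\equiv0$). Let $$\tilde f(z)=\Bigl(\operatorname{Re}f(z),\ \operatorname{Im}f(z),\ 2\operatorname{Im}\int_0^z h'(\zeta)q(\zeta)\,d\zeta\Bigr)\in\mathbb R^3$$ be the Weierstrass–Enneper lift of $f$ to a minimal surface. Put $\sigma=\log\lambda$, let $\mathcal Sf=2(\sigma_{zz}-\sigma_z^2)$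 with $\partial/\partial z=\frac12(\partial/\partial x-i\,\partial/\partial y)$ be the Schwarzian derivative of $f$, and let $K=-\lambda^{-2}\Delta\log\lambda$ be the Gauss curvature of the surface at $\tilde f(z)$. **Theorem 3.** Suppose that, for some extremal Nehari function $p$, $$|\mathcal Sf(z)|+\lambda(z)^2|K(\tilde f(z))|\le 2p(|z|),\qquad z\in\mathbb D.$$ Then $$|\tilde f(z_1)-\tilde f(z_2)|\ \ge\ \left\{\frac{\lambda(z_1)\lambda(z_2)}{F'(|z_1|)F'(|z_2|)}\right\}^{1/2}d(z_1,z_2),\qquad z_1,z_2\in\mathbb D,$$ where $d(z_1,z_2)=\frac12\log\frac{1+r}{1-r}$, $r=\left|\frac{z_1-z_2}{1-\overline{z_1}z_2}\right|$, is the hyperbolic distance of $\mathbb D$ for the metric $|dz|/(1-|z|^2)$. -/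

import Mathlib

open scoped Topology

noncomputable section

namespace HarmonicLift

/-- The open unit disk of the complex plane. -/
def disk : Set ℂ := Metric.ball (0 : ℂ) 1

/-! ### Nehari functions -/

/-- `u` is a (twice differentiable) solution of `u'' + p u = 0` on the interval `(-1, 1)`. -/
def IsSolution (p u : ℝ → ℝ) : Prop :=
  ∀ x ∈ Set.Ioo (-1 : ℝ) 1, DifferentiableAt ℝ u x ∧ HasDerivAt (deriv u) (-(p x * u x)) x

/-- Nehari functions: positive continuous even functions on `(-1, 1)` such that
`(1 - x^2)^2 p(x)` is nonincreasing on `[0, 1)` and no nontrivial solution of `u'' + p u = 0`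
has more than one zero in `(-1, 1)`. -/
structure IsNehari (p : ℝ → ℝ) : Prop where
  pos : ∀ x ∈ Set.Ioo (-1 : ℝ) 1, 0 < p x
  continuousOn : ContinuousOn p (Set.Ioo (-1 : ℝ) 1)
  even : ∀ x ∈ Set.Ioo (-1 : ℝ) 1, p (-x) = p x
  antitoneOn : AntitoneOn (fun x : ℝ => (1 - x ^ 2) ^ 2 * p x) (Set.Ico (0 : ℝ) 1)
  disconjugate : ∀ u : ℝ → ℝ, IsSolution p u → (∃ x ∈ Set.Ioo (-1 : ℝ) 1, u x ≠ 0) →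
    ∀ x ∈ Set.Ioo (-1 : ℝ) 1, ∀ y ∈ Set.Ioo (-1 : ℝ) 1, u x = 0 → u y = 0 → x = y

/-- A Nehari function `p` is extremal if `c p` is not a Nehari function for any `c > 1`. -/
def IsExtremalNehari (p : ℝ → ℝ) : Prop :=
  IsNehari p ∧ ∀ c : ℝ, 1 < c → ¬ IsNehari (fun x => c * p x)

/-- The function `F(x) = ∫_0^x u₀(t)^(-2) dt`. -/
def extremalF (u₀ : ℝ → ℝ) (x : ℝ) : ℝ := ∫ t in (0 : ℝ)..x, 1 / u₀ t ^ 2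

/-! ### Harmonic mappings and their lifts -/

/-- `f = h + conj g` is a harmonic mapping of the unit disk in its canonical decomposition
(`h`, `g` analytic and `g 0 = 0`), with `|h'| + |g'| ≠ 0`, whose dilatation `g' / h'` is the square
of the meromorphic function `q`. The identity `g' / h' = q ^ 2` is one of meromorphic functions, so
it is required on a punctured neighbourhood of each point of the disk. -/
structure IsLiftable (f h g q : ℂ → ℂ) : Prop where
  analytic_h : DifferentiableOn ℂ h disk
  analytic_g : DifferentiableOn ℂ g disk
  g_zero : g 0 = 0
  decomposition : ∀ z ∈ disk, f z = h z + (starRingEnd ℂ) (g z)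
  nonvanishing : ∀ z ∈ disk, ‖deriv h z‖ + ‖deriv g z‖ ≠ 0
  meromorphic : MeromorphicOn q disk
  dilatation : ∀ z ∈ disk, ∀ᶠ w in 𝓝[≠] z, deriv h w ≠ 0 ∧ deriv g w / deriv h w = q w ^ 2

/-- The conformal factor `λ = |h'| + |g'|`. -/
def conformalFactor (h g : ℂ → ℂ) (z : ℂ) : ℝ := ‖deriv h z‖ + ‖deriv g z‖

/-- The Weierstrass-Enneper lift `(Re f, Im f, 2 Im ∫_0^z h' q dζ)`, the integral being taken along
the segment from `0` to `z`. -/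
def lift (f h q : ℂ → ℂ) (z : ℂ) : EuclideanSpace ℝ (Fin 3) :=
  !₂[(f z).re, (f z).im,
    2 * (∫ t in (0 : ℝ)..1, deriv h ((t : ℂ) * z) * q ((t : ℂ) * z) * z).im]

/-- The operator `∂/∂z = (∂/∂x - i ∂/∂y) / 2`. -/
def dz (s : ℂ → ℂ) (z : ℂ) : ℂ :=
  (1 / 2 : ℂ) * (fderiv ℝ s z 1 - Complex.I * fderiv ℝ s z Complex.I)

/-- `σ = log λ`. -/
def sigma (h g : ℂ → ℂ) (z : ℂ) : ℝ := Real.log (conformalFactor h g z)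

/-- The Schwarzian derivative `2 (σ_zz - σ_z ^ 2)` of the harmonic mapping `h + conj g`. -/
def schwarzian (h g : ℂ → ℂ) (z : ℂ) : ℂ :=
  2 * (dz (dz (fun w => (sigma h g w : ℂ))) z - dz (fun w => (sigma h g w : ℂ)) z ^ 2)

/-- The Gauss curvature `K = - λ^(-2) Δ (log λ)` of the surface, at the image of `z`. -/
def gaussCurvature (h g : ℂ → ℂ) (z : ℂ) : ℝ :=
  -(1 / conformalFactor h g z ^ 2) * Laplacian.laplacian (sigma h g) z

/-- The hyperbolic distance of the unit disk for the metric `|dz| / (1 - |z|^2)`, that is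
`artanh r = (1/2) log ((1 + r) / (1 - r))` with `r = |z₁ - z₂| / |1 - conj z₁ * z₂|`. -/
def hypDist (z₁ z₂ : ℂ) : ℝ :=
  Real.artanh (‖z₁ - z₂‖ / ‖1 - (starRingEnd ℂ) z₁ * z₂‖)

end HarmonicLift

end

/-!
Along the geodesics of the disk the lift is a space curve to which a Sturm comparison applies.

*Curves.* For a curve `φ` in a Euclidean space with speed `exp τ`, the Ahlfors Schwarzian is
`τ'' - τ'² / 2` plus half the squared curvature times the squared speed. It is invariant under
inversions, so if it is at most `2 p` then `ω = |φ - φ(x₁)| exp (-τ / 2)`, the inverse square root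
of the speed of the inverted curve, satisfies `ω'' + p ω ≥ 0`. Comparison with the solution
`u₀ (F - F(x₁))` of `u'' + p u = 0` gives the two-point estimate `SchwarzianLE.le_norm_sub`, in
terms of `F(x₂) - F(x₁)`.

*The lift.* Locally `h' = a²`, `g' = b²`, `h' q = a b` for a holomorphic spinor `(a, b)`, and then
`λ = |a|² + |b|²`. In these terms the Schwarzian and the curvature have simple expressions
(`schwarzian_gaussCurvature_eq`), and the Ahlfors Schwarzian of the lift of the real axis is at
most `|𝒮f| + λ² |K|` (`spinor_curve`). Multiplying the spinor by a square root of `T'` gives the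
same for the lift along `T(-1, 1)`, `T` a Möbius map. Every geodesic is `T(-1, 1)` for a `T` with
`|T(x)| ≥ |x|`, obtained by sending `0` to the point of the geodesic closest to the origin;
because `(1 - x²)² p(x)` decreases, the bound by `2 p` is inherited (`IsLiftable.schwarzianLE`).

*Extremality.* To pass from the estimate along the geodesic to the stated one, it remains to know
that `(1 - x²) F'(x) = (1 - x²) / u₀(x)²` is nondecreasing on `[0, 1)`, which also yields
`F' ≥ 1 / (1 - x²)`. Let `W` be the derivative of `log (u₀ / √(1 - x²))` with respect to hyperbolic
arc length; it solves the Riccati equation `(1 - x²) W' + W² = 1 - (1 - x²)² p`. If `W` were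
positive somewhere on `[0, 1)`, it would stay bounded away from zero, because the right-hand side
is nondecreasing; this leaves room to subtract a small multiple of `sinh (N x)` from `W` and obtain
a strict Riccati inequality for `c p` with some `c > 1`, so that `c p` would be a Nehari function
(`IsExtremalNehari.hypLogDeriv_nonpos`).
-/

open scoped Topology

noncomputable section

namespace HarmonicLift

open Set Filter ComplexConjugate

/-! ### Solutions of `u'' + p u = 0` and disconjugacy -/

theorem IsSolution.hasDerivAt {p u : ℝ → ℝ} (hu : IsSolution p u) {x : ℝ}
    (hx : x ∈ Ioo (-1 : ℝ) 1) : HasDerivAt u (deriv u x) x :=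
  (hu x hx).1.hasDerivAt

/-- Uniqueness for the initial value problem with vanishing data. -/
theorem IsSolution.eq_zero {p u : ℝ → ℝ} (hp : ContinuousOn p (Ioo (-1 : ℝ) 1))
    (hu : IsSolution p u) {c : ℝ} (hc : c ∈ Ioo (-1 : ℝ) 1) (h0 : u c = 0) (h1 : deriv u c = 0) :
    ∀ x ∈ Ioo (-1 : ℝ) 1, u x = 0 := by
  intro x hx
  obtain ⟨r, hr, hr1⟩ : ∃ r, max |x| |c| < r ∧ r < 1 :=
    exists_between (max_lt (abs_lt.2 hx) (abs_lt.2 hc))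
  have hxr := abs_lt.1 ((le_max_left _ _).trans_lt hr)
  have hcr := abs_lt.1 ((le_max_right _ _).trans_lt hr)
  have hsub : Icc (-r) r ⊆ Ioo (-1 : ℝ) 1 := fun y hy => ⟨by linarith [hy.1], by linarith [hy.2]⟩
  obtain ⟨M, hM⟩ := isCompact_Icc.exists_bound_of_continuousOn (hp.mono hsub)
  have hM0 : 0 ≤ M := (norm_nonneg _).trans (hM c ⟨hcr.1.le, hcr.2.le⟩)
  have key := ODE_solution_unique_of_mem_Ioo (f := fun t => (u t, deriv u t))
    (g := fun _ => ((0 : ℝ), (0 : ℝ))) (v := fun t y => (y.2, -(p t * y.1)))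
    (s := fun _ => univ) (K := (max 1 M).toNNReal) (a := -r) (b := r) (t₀ := c)
    (by
      intro t ht
      have hpt := hM t (Ioo_subset_Icc_self ht)
      refine LipschitzOnWith.of_dist_le_mul fun y _ z _ => ?_
      rw [Real.coe_toNNReal _ (le_max_of_le_left zero_le_one), Prod.dist_eq]
      refine max_le ?_ ?_
      · calc dist y.2 z.2 ≤ dist y z := le_max_right _ _
          _ ≤ max 1 M * dist y z := le_mul_of_one_le_left dist_nonneg (le_max_left _ _)
      · have : dist (-(p t * y.1)) (-(p t * z.1)) = ‖p t‖ * dist y.1 z.1 := by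
          rw [Real.dist_eq, Real.dist_eq, Real.norm_eq_abs, ← abs_mul, ← abs_neg]
          congr 1; ring
        dsimp only
        rw [this]
        exact mul_le_mul (hpt.trans (le_max_right _ _)) (le_max_left _ _) dist_nonneg
          (le_max_of_le_left zero_le_one))
    hcr
    (fun t ht => ⟨(hu.hasDerivAt (hsub (Ioo_subset_Icc_self ht))).prodMk
      (hu t (hsub (Ioo_subset_Icc_self ht))).2, mem_univ _⟩)
    (fun t _ => ⟨(hasDerivAt_const t ((0 : ℝ), (0 : ℝ))).congr_deriv (by ext <;> simp), mem_univ _⟩)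
    (by simp [h0, h1])
  simpa using congrArg Prod.fst (key hxr)

/-- A strict Riccati inequality `V' + V² + p < 0` forces disconjugacy: for a solution `u` the
function `u (u' - V u)` is nondecreasing, and it vanishes at the zeros of `u`. -/
theorem disconjugate_of_riccati {p V V' : ℝ → ℝ} (hp : ContinuousOn p (Ioo (-1 : ℝ) 1))
    (hV : ∀ x ∈ Ioo (-1 : ℝ) 1, HasDerivAt V (V' x) x)
    (hlt : ∀ x ∈ Ioo (-1 : ℝ) 1, V' x + V x ^ 2 + p x < 0) {u : ℝ → ℝ} (hu : IsSolution p u)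
    (hne : ∃ x ∈ Ioo (-1 : ℝ) 1, u x ≠ 0) {x y : ℝ} (hx : x ∈ Ioo (-1 : ℝ) 1)
    (hy : y ∈ Ioo (-1 : ℝ) 1) (hux : u x = 0) (huy : u y = 0) : x = y := by
  wlog hxy : x < y generalizing x y
  · by_contra h
    exact h (this hy hx huy hux (lt_of_le_of_ne (not_lt.1 hxy) (Ne.symm h))).symm
  exfalso
  have hsub : Icc x y ⊆ Ioo (-1 : ℝ) 1 := fun t ht => ⟨hx.1.trans_le ht.1, ht.2.trans_lt hy.2⟩
  set G : ℝ → ℝ := fun t => u t * (deriv u t - V t * u t)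
  have hG : ∀ t ∈ Ioo (-1 : ℝ) 1, HasDerivAt G
      ((deriv u t - V t * u t) ^ 2 - u t ^ 2 * (V' t + V t ^ 2 + p t)) t := by
    intro t ht
    have h := (hu.hasDerivAt ht).mul ((hu t ht).2.sub ((hV t ht).mul (hu.hasDerivAt ht)))
    refine h.congr_deriv ?_
    simp only [Pi.sub_apply, Pi.mul_apply]
    ring
  have hmono : MonotoneOn G (Icc x y) := by
    refine monotoneOn_of_deriv_nonneg (convex_Icc x y)
      (fun t ht => (hG t (hsub ht)).continuousAt.continuousWithinAt)
      (fun t ht => (hG t (hsub (interior_subset ht))).differentiableAt.differentiableWithinAt) ?_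
    intro t ht
    rw [(hG t (hsub (interior_subset ht))).deriv]
    nlinarith [hlt t (hsub (interior_subset ht)), sq_nonneg (deriv u t - V t * u t),
      mul_nonneg (sq_nonneg (u t)) (neg_nonneg.2 (hlt t (hsub (interior_subset ht))).le)]
  have hGx : G x = 0 := by simp [G, hux]
  have hGy : G y = 0 := by simp [G, huy]
  have hG0 : ∀ t ∈ Icc x y, G t = 0 := fun t ht => le_antisymm
    (hGy ▸ hmono ht (right_mem_Icc.2 hxy.le) ht.2) (hGx ▸ hmono (left_mem_Icc.2 hxy.le) ht ht.1)
  -- the derivative of `G` is a sum of two nonnegative terms, so both vanish on `(x, y)`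
  obtain ⟨m, hm⟩ := exists_between hxy
  have hmI := hsub (Ioo_subset_Icc_self hm)
  have hd : (deriv u m - V m * u m) ^ 2 - u m ^ 2 * (V' m + V m ^ 2 + p m) = 0 := by
    have h0 : HasDerivAt G 0 m := (hasDerivAt_const m (0 : ℝ)).congr_of_eventuallyEq
      (Filter.eventually_of_mem (Icc_mem_nhds hm.1 hm.2) hG0)
    exact (hG m hmI).unique h0
  have hum : u m = 0 := by
    by_contra h
    have := mul_pos (pow_pos (abs_pos.2 h) 2) (neg_pos.2 (hlt m hmI))
    rw [sq_abs] at this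
    nlinarith [sq_nonneg (deriv u m - V m * u m)]
  have hum' : deriv u m = 0 := by
    rw [hum] at hd
    simpa using hd
  obtain ⟨w, hw, hw0⟩ := hne
  exact hw0 (hu.eq_zero hp hmI hum hum' w hw)

theorem neg_mem_Ioo {x : ℝ} (hx : x ∈ Ioo (-1 : ℝ) 1) : -x ∈ Ioo (-1 : ℝ) 1 :=
  ⟨by linarith [hx.2], by linarith [hx.1]⟩

/-- A solution with `u' 0 = 0` is even: its odd part solves the same equation with
vanishing initial data. -/
theorem IsNehari.solution_even {p u : ℝ → ℝ} (hp : IsNehari p) (hu : IsSolution p u)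
    (h1 : deriv u 0 = 0) {x : ℝ} (hx : x ∈ Ioo (-1 : ℝ) 1) : u (-x) = u x := by
  have hI0 : (0 : ℝ) ∈ Ioo (-1 : ℝ) 1 := by norm_num
  have hd : ∀ t ∈ Ioo (-1 : ℝ) 1,
      HasDerivAt (fun s => u s - u (-s)) (deriv u t + deriv u (-t)) t := by
    intro t ht
    have h := (hu.hasDerivAt ht).sub
      ((hu.hasDerivAt (neg_mem_Ioo ht)).comp t (hasDerivAt_neg t))
    exact h.congr_deriv (by ring)
  have hsol : IsSolution p (fun s => u s - u (-s)) := by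
    intro t ht
    refine ⟨(hd t ht).differentiableAt, ?_⟩
    have h := (hu t ht).2.add ((hu _ (neg_mem_Ioo ht)).2.comp t (hasDerivAt_neg t))
    refine (h.congr_deriv (f' := -(p t * u t) + -(p (-t) * u (-t)) * -1)
      rfl).congr_of_eventuallyEq ?_ |>.congr_deriv (by rw [hp.even t ht]; ring)
    filter_upwards [isOpen_Ioo.mem_nhds ht] with s hs using (hd s hs).deriv
  have := hsol.eq_zero hp.continuousOn hI0 (by simp) (by rw [(hd 0 hI0).deriv]; simp [h1]) x hx
  linarith

theorem IsNehari.deriv_solution_odd {p u : ℝ → ℝ} (hp : IsNehari p) (hu : IsSolution p u)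
    (h1 : deriv u 0 = 0) {x : ℝ} (hx : x ∈ Ioo (-1 : ℝ) 1) : deriv u (-x) = -deriv u x := by
  have h := (hu.hasDerivAt (neg_mem_Ioo hx)).comp x (hasDerivAt_neg x)
  have h' : HasDerivAt u (deriv u (-x) * -1) x := by
    refine h.congr_of_eventuallyEq ?_
    filter_upwards [isOpen_Ioo.mem_nhds hx] with s hs
    exact (hp.solution_even hu h1 hs).symm
  linarith [h'.unique (hu.hasDerivAt hx)]

theorem IsNehari.solution_pos {p u : ℝ → ℝ} (hp : IsNehari p) (hu : IsSolution p u)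
    (h0 : u 0 = 1) (h1 : deriv u 0 = 0) {x : ℝ} (hx : x ∈ Ioo (-1 : ℝ) 1) : 0 < u x := by
  have hI0 : (0 : ℝ) ∈ Ioo (-1 : ℝ) 1 := by norm_num
  have hne : ∀ y ∈ Ioo (-1 : ℝ) 1, u y ≠ 0 := by
    intro y hy h
    have := hp.disconjugate u hu ⟨0, hI0, by simp [h0]⟩ y hy (-y) (neg_mem_Ioo hy) h
      (by rw [hp.solution_even hu h1 hy, h])
    have hy0 : y = 0 := by linarith
    rw [hy0, h0] at h
    exact one_ne_zero h
  by_contra hneg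
  have hc : ContinuousOn u (Ioo (-1 : ℝ) 1) :=
    fun t ht => (hu t ht).1.continuousAt.continuousWithinAt
  obtain ⟨y, hy, hy0⟩ := isPreconnected_Ioo.intermediate_value hx hI0 hc
    (show (0 : ℝ) ∈ Icc (u x) (u 0) from ⟨not_lt.1 hneg, by rw [h0]; exact zero_le_one⟩)
  exact hne y hy hy0

/-! ### Extremal Nehari functions -/

/-- The logarithmic derivative of `u / √(1 - x ^ 2)` with respect to the hyperbolic arc length
`artanh x`. -/
def hypLogDeriv (u : ℝ → ℝ) (x : ℝ) : ℝ := (1 - x ^ 2) * (deriv u x / u x) + x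

theorem one_sub_sq_pos {x : ℝ} (hx : x ∈ Ioo (-1 : ℝ) 1) : 0 < 1 - x ^ 2 := by
  nlinarith [hx.1, hx.2]

/-- The Riccati equation. -/
theorem hasDerivAt_hypLogDeriv {p u : ℝ → ℝ} (hu : IsSolution p u) {x : ℝ}
    (hx : x ∈ Ioo (-1 : ℝ) 1) (hux : 0 < u x) :
    HasDerivAt (hypLogDeriv u)
      ((1 - (1 - x ^ 2) ^ 2 * p x - hypLogDeriv u x ^ 2) / (1 - x ^ 2)) x := by
  have hx2 := (one_sub_sq_pos hx).ne'
  have h1 : HasDerivAt (fun y : ℝ => 1 - y ^ 2) (-(2 * x)) x := by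
    simpa using (hasDerivAt_pow 2 x).const_sub 1
  have h := (h1.mul ((hu x hx).2.div (hu.hasDerivAt hx) hux.ne')).add (hasDerivAt_id x)
  refine h.congr_deriv ?_
  simp only [hypLogDeriv, Pi.div_apply]
  field_simp
  ring

theorem hypLogDeriv_zero {u : ℝ → ℝ} (h1 : deriv u 0 = 0) : hypLogDeriv u 0 = 0 := by
  simp [hypLogDeriv, h1]

theorem IsNehari.hypLogDeriv_odd {p u : ℝ → ℝ} (hp : IsNehari p) (hu : IsSolution p u)
    (h1 : deriv u 0 = 0) {x : ℝ} (hx : x ∈ Ioo (-1 : ℝ) 1) :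
    hypLogDeriv u (-x) = -hypLogDeriv u x := by
  rw [hypLogDeriv, hypLogDeriv, hp.solution_even hu h1 hx, hp.deriv_solution_odd hu h1 hx]
  ring

/-- `(1 - x ^ 2) ^ 2 p(x)` is bounded by its value at the origin. -/
theorem IsNehari.weight_le {p : ℝ → ℝ} (hp : IsNehari p) {x : ℝ} (hx : x ∈ Ioo (-1 : ℝ) 1) :
    (1 - x ^ 2) ^ 2 * p x ≤ p 0 := by
  have key : ∀ y ∈ Ico (0 : ℝ) 1, (1 - y ^ 2) ^ 2 * p y ≤ p 0 := fun y hy => by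
    simpa using hp.antitoneOn (by norm_num : (0 : ℝ) ∈ Ico (0 : ℝ) 1) hy hy.1
  rcases le_total 0 x with h | h
  · exact key x ⟨h, hx.2⟩
  · have := key (-x) ⟨by linarith, by linarith [hx.1]⟩
    rwa [neg_sq, hp.even x hx] at this

/-- Once the hyperbolic logarithmic derivative is positive, it stays bounded away from zero. -/
theorem IsNehari.exists_pos_le_hypLogDeriv {p u : ℝ → ℝ} (hp : IsNehari p) (hu : IsSolution p u)
    (hpos : ∀ x ∈ Ioo (-1 : ℝ) 1, 0 < u x) (h1 : deriv u 0 = 0) {x₀ : ℝ}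
    (hx₀ : x₀ ∈ Ioo (0 : ℝ) 1) (hW : 0 < hypLogDeriv u x₀) :
    ∃ k > 0, ∀ x ∈ Ico x₀ 1, k ≤ hypLogDeriv u x := by
  have hsub : Icc 0 x₀ ⊆ Ioo (-1 : ℝ) 1 := fun y hy => ⟨by linarith [hy.1], hy.2.trans_lt hx₀.2⟩
  have hd : ∀ x ∈ Ioo (-1 : ℝ) 1, HasDerivAt (hypLogDeriv u)
      ((1 - (1 - x ^ 2) ^ 2 * p x - hypLogDeriv u x ^ 2) / (1 - x ^ 2)) x :=
    fun x hx => hasDerivAt_hypLogDeriv hu hx (hpos x hx)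
  -- `W` increases somewhere before `x₀`, so `(1 - c ^ 2) ^ 2 * p c < 1` there, and this persists
  obtain ⟨c, hc, hc'⟩ := exists_hasDerivAt_eq_slope (hypLogDeriv u) _ hx₀.1
    (fun x hx => (hd x (hsub hx)).continuousAt.continuousWithinAt)
    (fun x hx => hd x (hsub (Ioo_subset_Icc_self hx)))
  rw [hypLogDeriv_zero h1, sub_zero, sub_zero] at hc'
  have hcI := hsub (Ioo_subset_Icc_self hc)
  have hδ : 0 < 1 - (1 - c ^ 2) ^ 2 * p c := by
    have h := div_pos hW hx₀.1
    rw [← hc', div_pos_iff_of_pos_right (one_sub_sq_pos hcI)] at h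
    nlinarith [sq_nonneg (hypLogDeriv u c)]
  set δ := 1 - (1 - c ^ 2) ^ 2 * p c with hδ_def
  obtain ⟨k, hk0, hk⟩ := exists_between (lt_min hW (Real.sqrt_pos.2 hδ))
  have hkW : k < hypLogDeriv u x₀ := hk.trans_le (min_le_left _ _)
  have hkδ : k ^ 2 < δ := (Real.lt_sqrt hk0.le).1 (hk.trans_le (min_le_right _ _))
  refine ⟨k, hk0, fun x hx => ?_⟩
  have hsub' : Icc x₀ x ⊆ Ioo (-1 : ℝ) 1 :=
    fun y hy => ⟨by linarith [hy.1, hx₀.1], hy.2.trans_lt hx.2⟩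
  have key := image_le_of_deriv_right_lt_deriv_boundary (f := fun y => -hypLogDeriv u y)
    (f' := fun y => -((1 - (1 - y ^ 2) ^ 2 * p y - hypLogDeriv u y ^ 2) / (1 - y ^ 2)))
    (a := x₀) (b := x) (B := fun _ => -k) (B' := fun _ => 0)
    (fun y hy => (hd y (hsub' hy)).neg.continuousAt.continuousWithinAt)
    (fun y hy => (hd y (hsub' (Ico_subset_Icc_self hy))).neg.hasDerivWithinAt)
    (by simpa using hkW.le) (fun y => hasDerivAt_const y _)
    (by
      intro y hy hyk
      have hyI := hsub' (Ico_subset_Icc_self hy)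
      have hanti := hp.antitoneOn ⟨hc.1.le, hcI.2⟩
        (show y ∈ Ico (0 : ℝ) 1 from ⟨by linarith [hx₀.1, hy.1], hyI.2⟩) (hc.2.le.trans hy.1)
      rw [neg_inj] at hyk
      rw [neg_lt_zero, div_pos_iff_of_pos_right (one_sub_sq_pos hyI), hyk]
      simp only at hanti
      linarith) (right_mem_Icc.2 hx.1)
  simpa using key

/-- For an extremal `p`, the function `u / √(1 - x²)` is nonincreasing on `[0, 1)`: otherwise the
Riccati inequality could be satisfied for `c p` with some `c > 1`. -/
theorem IsExtremalNehari.hypLogDeriv_nonpos {p u : ℝ → ℝ} (hp : IsExtremalNehari p)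
    (hu : IsSolution p u) (h0 : u 0 = 1) (h1 : deriv u 0 = 0) {x : ℝ} (hx : x ∈ Ico (0 : ℝ) 1) :
    hypLogDeriv u x ≤ 0 := by
  obtain ⟨hp, hext⟩ := hp
  by_contra! hW
  have hx0 : x ≠ 0 := by
    rintro rfl
    exact hW.ne' (hypLogDeriv_zero h1)
  have hxI : x ∈ Ioo (0 : ℝ) 1 := ⟨lt_of_le_of_ne hx.1 hx0.symm, hx.2⟩
  have hpos : ∀ y ∈ Ioo (-1 : ℝ) 1, 0 < u y := fun y hy => hp.solution_pos hu h0 h1 hy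
  obtain ⟨k, hk, hkW⟩ := hp.exists_pos_le_hypLogDeriv hu hpos h1 hxI hW
  have hd : ∀ y ∈ Ioo (-1 : ℝ) 1, HasDerivAt (hypLogDeriv u)
      ((1 - (1 - y ^ 2) ^ 2 * p y - hypLogDeriv u y ^ 2) / (1 - y ^ 2)) y :=
    fun y hy => hasDerivAt_hypLogDeriv hu hy (hpos y hy)
  obtain ⟨M, hM⟩ := isCompact_Icc.exists_bound_of_continuousOn
    (f := hypLogDeriv u) (s := Icc 0 x) (fun y hy =>
      (hd y ⟨by linarith [hy.1], hy.2.trans_lt hx.2⟩).continuousAt.continuousWithinAt)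
  have hM0 : 0 ≤ M := (norm_nonneg _).trans (hM 0 (left_mem_Icc.2 hx.1))
  have hx2 : 0 < 1 - x ^ 2 := by nlinarith [hxI.1, hxI.2]
  -- `N` is so large that on `[0, x]` the derivative of `sinh (N y)` outweighs the term containing
  -- `hypLogDeriv u y`, which may be negative there
  set N : ℝ := (2 * M + 1) / (1 - x ^ 2) with hN_def
  have hN : 0 < N := by positivity
  have hNx : N * (1 - x ^ 2) = 2 * M + 1 := by rw [hN_def]; field_simp
  set m : ℝ := min 1 (2 * k * Real.sinh (N * x)) with hm_def
  have hm : 0 < m := lt_min one_pos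
    (mul_pos (by positivity) (Real.sinh_pos_iff.2 (mul_pos hN hxI.1)))
  -- the gain in the Riccati inequality from subtracting a multiple of `sinh (N x)`
  have gain_nonneg : ∀ y ∈ Ico (0 : ℝ) 1, m ≤ (1 - y ^ 2) * (N * Real.cosh (N * y)) +
      2 * hypLogDeriv u y * Real.sinh (N * y) := by
    intro y hy
    have hs : 0 ≤ Real.sinh (N * y) := Real.sinh_nonneg_iff.2 (mul_nonneg hN.le hy.1)
    have hc : 1 ≤ Real.cosh (N * y) := Real.one_le_cosh _
    have hsc : Real.sinh (N * y) ≤ Real.cosh (N * y) := (Real.sinh_lt_cosh _).le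
    rcases le_total y x with hyx | hyx
    · refine (min_le_left _ _).trans ?_
      have h2 := (abs_le.1 (hM y ⟨hy.1, hyx⟩)).1
      have h3 : 2 * M + 1 ≤ (1 - y ^ 2) * N := by
        rw [← hNx, mul_comm]
        exact mul_le_mul_of_nonneg_right (by nlinarith [hy.1]) hN.le
      nlinarith [mul_le_mul_of_nonneg_right h3 (zero_le_one.trans hc),
        mul_le_mul_of_nonneg_right h2 hs, mul_le_mul_of_nonneg_left hsc hM0]
    · refine (min_le_right _ _).trans ?_
      have h2 := hkW y ⟨hyx, hy.2⟩
      have h3 : Real.sinh (N * x) ≤ Real.sinh (N * y) :=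
        Real.sinh_le_sinh.2 (mul_le_mul_of_nonneg_left hyx hN.le)
      have h4 : 0 ≤ (1 - y ^ 2) * (N * Real.cosh (N * y)) := by
        have : 0 < 1 - y ^ 2 := by nlinarith [hy.1, hy.2]
        positivity
      nlinarith [mul_le_mul h2 h3 (Real.sinh_nonneg_iff.2 (mul_pos hN hxI.1).le) (hk.le.trans h2)]
  have gain : ∀ y ∈ Ioo (-1 : ℝ) 1, m ≤ (1 - y ^ 2) * (N * Real.cosh (N * y)) +
      2 * hypLogDeriv u y * Real.sinh (N * y) := by
    intro y hy
    rcases le_total 0 y with h | h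
    · exact gain_nonneg y ⟨h, hy.2⟩
    · have := gain_nonneg (-y) ⟨by linarith, by linarith [hy.1]⟩
      rw [hp.hypLogDeriv_odd hu h1 hy, mul_neg, Real.cosh_neg, Real.sinh_neg] at this
      linarith
  have hsinh : ∀ y ∈ Ioo (-1 : ℝ) 1, Real.sinh (N * y) ^ 2 ≤ Real.sinh N ^ 2 := by
    intro y hy
    rw [sq_le_sq, Real.abs_sinh, Real.abs_sinh, Real.sinh_le_sinh, abs_mul]
    exact mul_le_of_le_one_right (abs_nonneg _) (abs_lt.2 hy).le
  have hp0 : 0 < p 0 := hp.pos 0 (by norm_num)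
  set ε : ℝ := m / (3 * (Real.sinh N ^ 2 + 1)) with hε_def
  have hε : 0 < ε := by positivity
  have hεN : ε * Real.sinh N ^ 2 ≤ m / 3 := by
    rw [hε_def, div_mul_eq_mul_div, div_le_div_iff₀ (by positivity) (by positivity)]
    nlinarith
  set c : ℝ := 1 + ε * m / (3 * p 0) with hc_def
  have hc : 1 < c := by
    rw [hc_def]
    have : 0 < ε * m / (3 * p 0) := by positivity
    linarith
  have hcp : (c - 1) * p 0 = ε * (m / 3) := by
    rw [hc_def]
    field_simp
    ring
  refine hext c hc ⟨fun y hy => mul_pos (by linarith) (hp.pos y hy),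
    continuousOn_const.mul hp.continuousOn, fun y hy => by rw [hp.even y hy], ?_, ?_⟩
  · intro y hy z hz hyz
    have := mul_le_mul_of_nonneg_left (hp.antitoneOn hy hz hyz) (zero_lt_one.trans hc).le
    simp only at this ⊢
    linarith
  · intro v hv hne y hy z hz hvy hvz
    refine disconjugate_of_riccati (p := fun x => c * p x)
      (continuousOn_const.mul hp.continuousOn)
      (V := fun t => (hypLogDeriv u t - ε * Real.sinh (N * t) - t) / (1 - t ^ 2))
      (V' := fun t => ((((1 - (1 - t ^ 2) ^ 2 * p t - hypLogDeriv u t ^ 2) / (1 - t ^ 2)) -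
        ε * (Real.cosh (N * t) * N) - 1) * (1 - t ^ 2) -
        (hypLogDeriv u t - ε * Real.sinh (N * t) - t) * (-(2 * t))) / (1 - t ^ 2) ^ 2)
      ?_ ?_ hv hne hy hz hvy hvz
    · intro t ht
      have h1 : HasDerivAt (fun y : ℝ => 1 - y ^ 2) (-(2 * t)) t := by
        simpa using (hasDerivAt_pow 2 t).const_sub 1
      have h2 : HasDerivAt (fun y : ℝ => Real.sinh (N * y)) (Real.cosh (N * t) * N) t := by
        simpa using ((hasDerivAt_id t).const_mul N).sinh
      exact (((hd t ht).sub (h2.const_mul ε)).sub (hasDerivAt_id t)).div h1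
        (one_sub_sq_pos ht).ne'
    · intro t ht
      have ht2 := one_sub_sq_pos ht
      have hg := gain t ht
      have hs := hsinh t ht
      have hw := hp.weight_le ht
      have key : (1 - t ^ 2) ^ 2 * (((((1 - (1 - t ^ 2) ^ 2 * p t - hypLogDeriv u t ^ 2) /
          (1 - t ^ 2)) - ε * (Real.cosh (N * t) * N) - 1) * (1 - t ^ 2) -
          (hypLogDeriv u t - ε * Real.sinh (N * t) - t) * (-(2 * t))) / (1 - t ^ 2) ^ 2 +
          ((hypLogDeriv u t - ε * Real.sinh (N * t) - t) / (1 - t ^ 2)) ^ 2 + c * p t) =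
          -ε * ((1 - t ^ 2) * (N * Real.cosh (N * t)) +
            2 * hypLogDeriv u t * Real.sinh (N * t)) + ε * (ε * Real.sinh (N * t) ^ 2) +
            (c - 1) * ((1 - t ^ 2) ^ 2 * p t) := by
        field_simp
        ring
      have h3 : (c - 1) * ((1 - t ^ 2) ^ 2 * p t) ≤ ε * (m / 3) :=
        hcp ▸ mul_le_mul_of_nonneg_left hw (by linarith)
      have h4 : ε * (ε * Real.sinh (N * t) ^ 2) ≤ ε * (m / 3) :=
        mul_le_mul_of_nonneg_left ((mul_le_mul_of_nonneg_left hs hε.le).trans hεN) hε.le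
      have h5 := mul_le_mul_of_nonneg_left hg hε.le
      have h6 := mul_pos hε hm
      refine neg_of_mul_neg_right (a := (1 - t ^ 2) ^ 2) ?_ (by positivity)
      refine key.trans_lt ?_
      linarith

/-- `u₀(x) ^ 2 / (1 - x ^ 2)` decreases on `[0, 1)`, that is, `(1 - x ^ 2) F'(x)` increases. -/
theorem IsExtremalNehari.antitoneOn_sq_div {p u : ℝ → ℝ} (hp : IsExtremalNehari p)
    (hu : IsSolution p u) (h0 : u 0 = 1) (h1 : deriv u 0 = 0) :
    AntitoneOn (fun x => u x ^ 2 / (1 - x ^ 2)) (Ico (0 : ℝ) 1) := by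
  have hsub : Ico (0 : ℝ) 1 ⊆ Ioo (-1 : ℝ) 1 := fun y hy => ⟨by linarith [hy.1], hy.2⟩
  have hd : ∀ x ∈ Ioo (-1 : ℝ) 1, HasDerivAt (fun x => u x ^ 2 / (1 - x ^ 2))
      (2 * (u x / (1 - x ^ 2)) ^ 2 * hypLogDeriv u x) x := by
    intro x hx
    have h2 : HasDerivAt (fun y : ℝ => 1 - y ^ 2) (-(2 * x)) x := by
      simpa using (hasDerivAt_pow 2 x).const_sub 1
    have hx2 := (one_sub_sq_pos hx).ne'
    have hux := (hp.1.solution_pos hu h0 h1 hx).ne'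
    refine (((hu.hasDerivAt hx).pow 2).div h2 hx2).congr_deriv ?_
    simp only [hypLogDeriv, Pi.pow_apply]
    field_simp
    ring
  refine antitoneOn_of_deriv_nonpos (convex_Ico 0 1)
    (fun x hx => (hd x (hsub hx)).continuousAt.continuousWithinAt)
    (fun x hx => (hd x (hsub (interior_subset hx))).differentiableAt.differentiableWithinAt) ?_
  intro x hx
  rw [(hd x (hsub (interior_subset hx))).deriv]
  exact mul_nonpos_of_nonneg_of_nonpos (by positivity)
    (hp.hypLogDeriv_nonpos hu h0 h1 (interior_subset hx))

/-! ### Curves with bounded Ahlfors Schwarzian -/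

theorem hasDerivAt_extremalF {u : ℝ → ℝ} (hc : ContinuousOn u (Ioo (-1 : ℝ) 1))
    (hpos : ∀ x ∈ Ioo (-1 : ℝ) 1, 0 < u x) {x : ℝ} (hx : x ∈ Ioo (-1 : ℝ) 1) :
    HasDerivAt (extremalF u) (1 / u x ^ 2) x := by
  have hcont : ContinuousOn (fun t => 1 / u t ^ 2) (Ioo (-1 : ℝ) 1) :=
    continuousOn_const.div (hc.pow 2) fun t ht => (pow_pos (hpos t ht) 2).ne'
  refine intervalIntegral.integral_hasDerivAt_right ?_ ?_ ?_
  · refine (hcont.mono ?_).intervalIntegrable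
    exact ordConnected_Ioo.uIcc_subset (by norm_num) hx
  · exact hcont.stronglyMeasurableAtFilter isOpen_Ioo x hx
  · exact hcont.continuousAt (isOpen_Ioo.mem_nhds hx)

section Curve

variable {E : Type*} [NormedAddCommGroup E] [InnerProductSpace ℝ E]

/-- A regular `C²` curve `φ` on `(-1, 1)` with speed `exp τ` whose Ahlfors Schwarzian is at most
`2 p`. The functions `φ₁, φ₂` and `τ₁, τ₂` are the first two derivatives of `φ` and of `τ`;
`φ₂ - τ₁ φ₁` is the component of the acceleration orthogonal to the velocity. -/
structure SchwarzianLE (p : ℝ → ℝ) (φ φ₁ φ₂ : ℝ → E) (τ τ₁ τ₂ : ℝ → ℝ) : Prop where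
  hasDerivAt : ∀ x ∈ Ioo (-1 : ℝ) 1, HasDerivAt φ (φ₁ x) x
  hasDerivAt' : ∀ x ∈ Ioo (-1 : ℝ) 1, HasDerivAt φ₁ (φ₂ x) x
  hasDerivAt_log_speed : ∀ x ∈ Ioo (-1 : ℝ) 1, HasDerivAt τ (τ₁ x) x
  hasDerivAt_log_speed' : ∀ x ∈ Ioo (-1 : ℝ) 1, HasDerivAt τ₁ (τ₂ x) x
  norm_eq : ∀ x ∈ Ioo (-1 : ℝ) 1, ‖φ₁ x‖ = Real.exp (τ x)
  le : ∀ x ∈ Ioo (-1 : ℝ) 1,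
    τ₂ x - τ₁ x ^ 2 / 2 + ‖φ₂ x - τ₁ x • φ₁ x‖ ^ 2 / (2 * Real.exp (τ x) ^ 2) ≤ 2 * p x

variable {p : ℝ → ℝ} {φ φ₁ φ₂ : ℝ → E} {τ τ₁ τ₂ : ℝ → ℝ}

/-- The curvature part of the acceleration is orthogonal to the velocity. -/
theorem SchwarzianLE.inner_eq_zero (h : SchwarzianLE p φ φ₁ φ₂ τ τ₁ τ₂) {x : ℝ}
    (hx : x ∈ Ioo (-1 : ℝ) 1) : inner ℝ (φ₂ x - τ₁ x • φ₁ x) (φ₁ x) = 0 := by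
  have h1 := (h.hasDerivAt' x hx).norm_sq
  have h2 := ((h.hasDerivAt_log_speed x hx).exp.pow 2)
  have h3 : HasDerivAt (‖φ₁ ·‖ ^ 2) _ x := h2.congr_of_eventuallyEq (by
    filter_upwards [isOpen_Ioo.mem_nhds hx] with y hy
    simp [h.norm_eq y hy])
  have h4 := h1.unique h3
  rw [inner_sub_left, real_inner_smul_left, real_inner_self_eq_norm_sq, h.norm_eq x hx,
    real_inner_comm]
  norm_num at h4
  linarith

/-- The distance to `c` along `φ`, divided by the square root of the speed. It is the
inverse square root of the speed of the image of `φ` under the inversion centred at `c`. -/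
def invertedSpeed (φ : ℝ → E) (τ : ℝ → ℝ) (c : E) (x : ℝ) : ℝ :=
  ‖φ x - c‖ * Real.exp (-τ x / 2)

/-- The derivative of `invertedSpeed`. -/
def invertedSpeedDeriv (φ φ₁ : ℝ → E) (τ τ₁ : ℝ → ℝ) (c : E) (x : ℝ) : ℝ :=
  (inner ℝ (φ x - c) (φ₁ x) / ‖φ x - c‖ - τ₁ x / 2 * ‖φ x - c‖) * Real.exp (-τ x / 2)

theorem hasDerivAt_norm_sub {c v : E} {x : ℝ} (hφ : HasDerivAt φ v x) (hc : φ x ≠ c) :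
    HasDerivAt (fun y => ‖φ y - c‖) (inner ℝ (φ x - c) v / ‖φ x - c‖) x := by
  have h0 : ‖φ x - c‖ ≠ 0 := norm_ne_zero_iff.2 (sub_ne_zero.2 hc)
  have h := ((hφ.sub_const c).norm_sq).sqrt (by positivity)
  simp only [Real.sqrt_sq (norm_nonneg _)] at h
  exact h.congr_deriv (by field_simp)

theorem SchwarzianLE.hasDerivAt_invertedSpeed (h : SchwarzianLE p φ φ₁ φ₂ τ τ₁ τ₂) {c : E}
    {x : ℝ} (hx : x ∈ Ioo (-1 : ℝ) 1) (hc : φ x ≠ c) :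
    HasDerivAt (invertedSpeed φ τ c) (invertedSpeedDeriv φ φ₁ τ τ₁ c x) x := by
  have h1 := (hasDerivAt_norm_sub (h.hasDerivAt x hx) hc).mul
    (((h.hasDerivAt_log_speed x hx).neg.div_const 2).exp)
  refine h1.congr_deriv ?_
  simp only [invertedSpeedDeriv, Pi.neg_apply]
  ring

/-- The differential inequality `ω'' + p ω ≥ 0` for `ω = invertedSpeed`; it expresses the Möbius
invariance of the Ahlfors Schwarzian, and reduces to the nonnegativity of a square. -/
theorem SchwarzianLE.exists_hasDerivAt_invertedSpeedDeriv (h : SchwarzianLE p φ φ₁ φ₂ τ τ₁ τ₂)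
    {c : E} {x : ℝ} (hx : x ∈ Ioo (-1 : ℝ) 1) (hc : φ x ≠ c) :
    ∃ w, HasDerivAt (invertedSpeedDeriv φ φ₁ τ τ₁ c) w x ∧
      0 ≤ w + p x * invertedSpeed φ τ c x := by
  have hρ : 0 < ‖φ x - c‖ := norm_pos_iff.2 (sub_ne_zero.2 hc)
  have hn := hasDerivAt_norm_sub (h.hasDerivAt x hx) hc
  have h1 := ((((((h.hasDerivAt x hx).sub_const c).inner ℝ (h.hasDerivAt' x hx)).div hn hρ.ne').sub
    (((h.hasDerivAt_log_speed' x hx).div_const 2).mul hn)).mul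
    (((h.hasDerivAt_log_speed x hx).neg.div_const 2).exp))
  refine ⟨_, h1, ?_⟩
  have hv : 0 < Real.exp (τ x) := Real.exp_pos _
  have hle := h.le x hx
  have horth := h.inner_eq_zero hx
  have hnorm := h.norm_eq x hx
  simp only [invertedSpeed, Pi.neg_apply, Pi.sub_apply, Pi.div_apply, Pi.mul_apply,
    real_inner_self_eq_norm_sq]
  set D := φ x - c with hD
  set v := Real.exp (τ x) with hv_def
  set ρ := ‖D‖ with hρ_def
  set e := Real.exp (-τ x / 2) with he_def
  have he : 0 < e := Real.exp_pos _
  set k := φ₂ x - τ₁ x • φ₁ x with hk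
  have hφ₂ : φ₂ x = k + τ₁ x • φ₁ x := by rw [hk]; abel
  set a := inner ℝ D (φ₁ x) with ha
  -- the square whose nonnegativity gives the inequality
  have hsq : 0 ≤ ‖(v / ρ) • (D - (a / v ^ 2) • φ₁ x) + (ρ / (2 * v)) • k‖ ^ 2 := sq_nonneg _
  have hk1 : inner ℝ (φ₁ x) k = 0 := by rw [real_inner_comm]; exact horth
  have hin : inner ℝ (D - (a / v ^ 2) • φ₁ x) k = inner ℝ D k :=
    (inner_sub_left _ _ _).trans (by rw [real_inner_smul_left, hk1, mul_zero, sub_zero])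
  rw [norm_add_sq_real, norm_smul, norm_smul, mul_pow, mul_pow, norm_sub_sq_real, norm_smul,
    real_inner_smul_left, real_inner_smul_right, ← ha, real_inner_smul_right, hin, ← hρ_def,
    mul_pow, hnorm] at hsq
  simp only [Real.norm_eq_abs, sq_abs] at hsq
  rw [hφ₂, inner_add_right, real_inner_smul_right, ← ha, hnorm]
  set b := inner ℝ D k
  set K := ‖k‖ ^ 2
  have hsq' : 0 ≤ v ^ 2 - a ^ 2 / ρ ^ 2 + b + ρ ^ 2 / (4 * v ^ 2) * K := by
    refine hsq.trans_eq ?_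
    field_simp
    ring
  have hle' : ρ ^ 2 / 2 * (τ₂ x - τ₁ x ^ 2 / 2 + K / (2 * v ^ 2)) ≤ ρ ^ 2 / 2 * (2 * p x) :=
    mul_le_mul_of_nonneg_left hle (by positivity)
  have hfin : 0 ≤ (v ^ 2 - a ^ 2 / ρ ^ 2 + b - ρ ^ 2 / 2 * (τ₂ x - τ₁ x ^ 2 / 2) +
      ρ ^ 2 * p x) * (e / ρ) := by
    refine mul_nonneg ?_ (by positivity)
    have : ρ ^ 2 / 2 * (K / (2 * v ^ 2)) = ρ ^ 2 / (4 * v ^ 2) * K := by field_simp; ring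
    linarith
  refine hfin.trans_eq ?_
  field_simp
  ring

theorem SchwarzianLE.tendsto_invertedSpeedDeriv (h : SchwarzianLE p φ φ₁ φ₂ τ τ₁ τ₂) {x : ℝ}
    (hx : x ∈ Ioo (-1 : ℝ) 1) :
    Tendsto (invertedSpeedDeriv φ φ₁ τ τ₁ (φ x)) (𝓝[>] x) (𝓝 (Real.exp (τ x / 2))) := by
  have hv : 0 < Real.exp (τ x) := Real.exp_pos _
  have hs : Tendsto (slope φ x) (𝓝[>] x) (𝓝 (φ₁ x)) :=
    (hasDerivAt_iff_tendsto_slope.1 (h.hasDerivAt x hx)).mono_left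
      (nhdsWithin_mono _ fun y hy => (ne_of_gt hy : y ≠ x))
  have hφ₁ : Tendsto φ₁ (𝓝[>] x) (𝓝 (φ₁ x)) :=
    (h.hasDerivAt' x hx).continuousAt.tendsto.mono_left nhdsWithin_le_nhds
  have hτ₁ : Tendsto τ₁ (𝓝[>] x) (𝓝 (τ₁ x)) :=
    (h.hasDerivAt_log_speed' x hx).continuousAt.tendsto.mono_left nhdsWithin_le_nhds
  have hτ : Tendsto τ (𝓝[>] x) (𝓝 (τ x)) :=
    (h.hasDerivAt_log_speed x hx).continuousAt.tendsto.mono_left nhdsWithin_le_nhds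
  have hφ : Tendsto φ (𝓝[>] x) (𝓝 (φ x)) :=
    (h.hasDerivAt x hx).continuousAt.tendsto.mono_left nhdsWithin_le_nhds
  have h1 : Tendsto (fun y => inner ℝ (slope φ x y) (φ₁ y) / ‖slope φ x y‖) (𝓝[>] x)
      (𝓝 (inner ℝ (φ₁ x) (φ₁ x) / ‖φ₁ x‖)) :=
    (hs.inner hφ₁).div hs.norm (by rw [h.norm_eq x hx]; exact hv.ne')
  have h2 := (h1.sub ((hτ₁.div_const 2).mul (hφ.sub_const (φ x)).norm)).mul
    ((Real.continuous_exp.tendsto _).comp (hτ.neg.div_const 2))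
  have hlim : (inner ℝ (φ₁ x) (φ₁ x) / ‖φ₁ x‖ - τ₁ x / 2 * ‖φ x - φ x‖) * Real.exp (-τ x / 2) =
      Real.exp (τ x / 2) := by
    rw [real_inner_self_eq_norm_sq, h.norm_eq x hx, sub_self, norm_zero, mul_zero, sub_zero,
      pow_two, mul_self_div_self, ← Real.exp_add]
    congr 1; ring
  rw [hlim] at h2
  refine h2.congr' ?_
  filter_upwards [self_mem_nhdsWithin] with y hy
  have hyx : 0 < y - x := sub_pos.2 hy
  simp only [invertedSpeedDeriv, slope, vsub_eq_sub, real_inner_smul_left, norm_smul, norm_inv,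
    Real.norm_eq_abs, abs_of_pos hyx, Function.comp_apply]
  congr 2
  exact mul_div_mul_left _ _ (inv_pos.2 hyx).ne'

/-- Sturm comparison of `invertedSpeed` with the solution `u ∫ u⁻²`, on an interval on which `φ`
does not return to its starting point. -/
theorem SchwarzianLE.le_invertedSpeed (h : SchwarzianLE p φ φ₁ φ₂ τ τ₁ τ₂) {u : ℝ → ℝ}
    (hu : IsSolution p u) (hpos : ∀ x ∈ Ioo (-1 : ℝ) 1, 0 < u x) {x y : ℝ}
    (hx : x ∈ Ioo (-1 : ℝ) 1) (hy : y ∈ Ioo (-1 : ℝ) 1) (hxy : x < y)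
    (hne : ∀ z ∈ Ioo x y, φ z ≠ φ x) :
    Real.exp (τ x / 2) * u x * u y * (extremalF u y - extremalF u x) ≤
      invertedSpeed φ τ (φ x) y := by
  have hsub : Icc x y ⊆ Ioo (-1 : ℝ) 1 := fun t ht => ⟨hx.1.trans_le ht.1, ht.2.trans_lt hy.2⟩
  have hucont : ContinuousOn u (Ioo (-1 : ℝ) 1) :=
    fun t ht => (hu t ht).1.continuousAt.continuousWithinAt
  set ω := invertedSpeed φ τ (φ x)
  set ω₁ := invertedSpeedDeriv φ φ₁ τ τ₁ (φ x)
  set W : ℝ → ℝ := fun t => ω₁ t * u t - ω t * deriv u t with hW_def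
  set W₀ := Real.exp (τ x / 2) * u x with hW₀
  have hωd : ∀ t ∈ Ioo x y, HasDerivAt ω (ω₁ t) t := fun t ht =>
    h.hasDerivAt_invertedSpeed (hsub (Ioo_subset_Icc_self ht)) (hne t ht)
  have hWd : ∀ t ∈ Ioo x y, ∃ d, HasDerivAt W d t ∧ 0 ≤ d := by
    intro t ht
    have htI := hsub (Ioo_subset_Icc_self ht)
    obtain ⟨w, hw, hw0⟩ := h.exists_hasDerivAt_invertedSpeedDeriv htI (hne t ht)
    refine ⟨_, (hw.mul (hu.hasDerivAt htI)).sub ((hωd t ht).mul (hu t htI).2), ?_⟩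
    nlinarith [mul_nonneg hw0 (hpos t htI).le]
  have hWmono : MonotoneOn W (Ioo x y) := by
    refine monotoneOn_of_deriv_nonneg (convex_Ioo x y) (fun t ht => ?_) (fun t ht => ?_)
      (fun t ht => ?_)
    · obtain ⟨d, hd, -⟩ := hWd t ht
      exact hd.continuousAt.continuousWithinAt
    · obtain ⟨d, hd, -⟩ := hWd t (interior_subset ht)
      exact hd.differentiableAt.differentiableWithinAt
    · obtain ⟨d, hd, hd0⟩ := hWd t (interior_subset ht)
      rwa [hd.deriv]
  have hωc : ∀ t ∈ Icc x y, ContinuousAt ω t := fun t ht =>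
    (((h.hasDerivAt t (hsub ht)).continuousAt.sub continuousAt_const).norm).mul
      (Real.continuous_exp.continuousAt.comp
        ((h.hasDerivAt_log_speed t (hsub ht)).continuousAt.neg.div_const 2))
  have hxm : x ∈ Icc x y := left_mem_Icc.2 hxy.le
  have hωx : ω x = 0 := by simp [ω, invertedSpeed]
  have hWlim : Tendsto W (𝓝[>] x) (𝓝 W₀) := by
    have h1 := ((h.tendsto_invertedSpeedDeriv hx).mul
      ((hu x hx).1.continuousAt.tendsto.mono_left nhdsWithin_le_nhds)).sub
      (((hωc x hxm).tendsto.mono_left nhdsWithin_le_nhds).mul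
      ((hu x hx).2.continuousAt.tendsto.mono_left nhdsWithin_le_nhds))
    rwa [hωx, zero_mul, sub_zero] at h1
  have hWge : ∀ t ∈ Ioo x y, W₀ ≤ W t := by
    intro t ht
    refine le_of_tendsto hWlim ?_
    filter_upwards [Ioo_mem_nhdsGT ht.1] with s hs
    exact hWmono ⟨hs.1, hs.2.trans ht.2⟩ ht hs.2.le
  have hF : ∀ t ∈ Icc x y, HasDerivAt (extremalF u) (1 / u t ^ 2) t :=
    fun t ht => hasDerivAt_extremalF hucont hpos (hsub ht)
  have hGd : ∀ t ∈ Ioo x y, HasDerivAt (fun t => ω t / u t - W₀ * extremalF u t)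
      ((W t - W₀) / u t ^ 2) t := by
    intro t ht
    have htc := Ioo_subset_Icc_self ht
    have hut := (hpos t (hsub htc)).ne'
    refine (((hωd t ht).div (hu.hasDerivAt (hsub htc)) hut).sub
      ((hF t htc).const_mul W₀)).congr_deriv ?_
    rw [hW_def]
    field_simp
  have hG : MonotoneOn (fun t => ω t / u t - W₀ * extremalF u t) (Icc x y) := by
    refine monotoneOn_of_deriv_nonneg (convex_Icc x y) (fun t ht => ?_) (fun t ht => ?_)
      (fun t ht => ?_)
    · exact (((hωc t ht).div (hu t (hsub ht)).1.continuousAt (hpos t (hsub ht)).ne').sub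
        (continuousAt_const.mul (hF t ht).continuousAt)).continuousWithinAt
    · rw [interior_Icc] at ht
      exact (hGd t ht).differentiableAt.differentiableWithinAt
    · rw [interior_Icc] at ht
      rw [(hGd t ht).deriv]
      exact div_nonneg (sub_nonneg.2 (hWge t ht)) (sq_nonneg _)
  have hfin := hG hxm (right_mem_Icc.2 hxy.le) hxy.le
  simp only [hωx, zero_div, zero_sub] at hfin
  have huy := hpos y hy
  have h2 : W₀ * (extremalF u y - extremalF u x) ≤ ω y / u y := by linarith
  rw [le_div_iff₀ huy] at h2
  linarith

/-- Two-point distortion for curves: the quantitative form of the injectivity of curves whose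
Ahlfors Schwarzian is at most `2 p`. -/
theorem SchwarzianLE.le_norm_sub (h : SchwarzianLE p φ φ₁ φ₂ τ τ₁ τ₂) {u : ℝ → ℝ}
    (hu : IsSolution p u) (hpos : ∀ x ∈ Ioo (-1 : ℝ) 1, 0 < u x) {x y : ℝ}
    (hx : x ∈ Ioo (-1 : ℝ) 1) (hy : y ∈ Ioo (-1 : ℝ) 1) (hxy : x < y) :
    Real.exp (τ x / 2) * Real.exp (τ y / 2) * (u x * u y) * (extremalF u y - extremalF u x) ≤
      ‖φ y - φ x‖ := by
  have hsub : Icc x y ⊆ Ioo (-1 : ℝ) 1 := fun t ht => ⟨hx.1.trans_le ht.1, ht.2.trans_lt hy.2⟩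
  have hucont : ContinuousOn u (Ioo (-1 : ℝ) 1) :=
    fun t ht => (hu t ht).1.continuousAt.continuousWithinAt
  have hFmono : StrictMonoOn (extremalF u) (Ioo (-1 : ℝ) 1) := by
    refine strictMonoOn_of_deriv_pos (convex_Ioo _ _)
      (fun t ht => (hasDerivAt_extremalF hucont hpos ht).continuousAt.continuousWithinAt)
      fun t ht => ?_
    rw [(hasDerivAt_extremalF hucont hpos (interior_subset ht)).deriv]
    exact one_div_pos.2 (pow_pos (hpos t (interior_subset ht)) 2)
  have hne : ∀ z ∈ Ioo x y, φ z ≠ φ x := by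
    by_contra! hcon
    -- the set of return times is closed because `φ` is injective near `x`; take the first one
    have hev : ∀ᶠ z in 𝓝[>] x, φ z ≠ φ x :=
      ((h.hasDerivAt x hx).eventually_ne (norm_ne_zero_iff.1
        (by rw [h.norm_eq x hx]; exact (Real.exp_pos _).ne'))).filter_mono
        (nhdsWithin_mono _ fun y hy => (ne_of_gt hy : y ≠ x))
    obtain ⟨b, hb, hbne⟩ := mem_nhdsGT_iff_exists_Ioo_subset.1 hev
    obtain ⟨z₀, hz₀, hz₀'⟩ := hcon
    have hbz : b ≤ z₀ := by
      by_contra! hlt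
      exact hbne ⟨hz₀.1, hlt⟩ hz₀'
    have hsub' : Icc b z₀ ⊆ Icc x y := Icc_subset_Icc (le_of_lt hb) hz₀.2.le
    have hcompact : IsCompact (Icc b z₀ ∩ φ ⁻¹' {φ x}) := by
      refine isCompact_Icc.of_isClosed_subset
        (ContinuousOn.preimage_isClosed_of_isClosed (fun t ht =>
          (h.hasDerivAt t (hsub (hsub' ht))).continuousAt.continuousWithinAt) isClosed_Icc
          isClosed_singleton) inter_subset_left
    obtain ⟨z, hz, hzmin⟩ := hcompact.exists_isLeast ⟨z₀, right_mem_Icc.2 hbz, hz₀'⟩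
    have hxz : x < z := lt_of_lt_of_le hb hz.1.1
    have hzI : z ∈ Ioo (-1 : ℝ) 1 := hsub (hsub' hz.1)
    have key := h.le_invertedSpeed hu hpos hx hzI hxz (fun t ht htx => by
      rcases lt_or_ge t b with htb | htb
      · exact hbne ⟨ht.1, htb⟩ htx
      · exact absurd (hzmin ⟨⟨htb, ht.2.le.trans hz.1.2⟩, htx⟩) (not_le.2 ht.2))
    have hzx : φ z = φ x := hz.2
    rw [invertedSpeed, hzx, sub_self, norm_zero, zero_mul] at key
    have := mul_pos (mul_pos (mul_pos (Real.exp_pos (τ x / 2)) (hpos x hx)) (hpos z hzI))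
      (sub_pos.2 (hFmono hx hzI hxz))
    linarith
  have key := h.le_invertedSpeed hu hpos hx hy hxy hne
  rw [invertedSpeed] at key
  have h1 : Real.exp (-τ y / 2) * Real.exp (τ y / 2) = 1 := by
    rw [← Real.exp_add, neg_div, neg_add_cancel, Real.exp_zero]
  calc _ = Real.exp (τ x / 2) * u x * u y * (extremalF u y - extremalF u x) *
        Real.exp (τ y / 2) := by ring
    _ ≤ ‖φ y - φ x‖ * Real.exp (-τ y / 2) * Real.exp (τ y / 2) :=
      mul_le_mul_of_nonneg_right key (Real.exp_pos _).le
    _ = ‖φ y - φ x‖ := by rw [mul_assoc, h1, mul_one]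

end Curve

/-! ### Curves generated by spinors -/

/-- The squared length `|a|² + |b|²` of the spinor `(a, b)`. -/
def spinorNormSq (a b : ℂ) : ℝ := Complex.normSq a + Complex.normSq b

/-- The isotropic vector `(a² + b², -i (a² - b²), -2 i a b)` of `ℂ³` attached to the spinor
`(a, b)`; only its real part is recorded. -/
def spinorVec (a b : ℂ) : EuclideanSpace ℝ (Fin 3) :=
  !₂[(a ^ 2 + b ^ 2).re, (a ^ 2 - b ^ 2).im, 2 * (a * b).im]

/-- The Schwarzian `2 (σ'' - σ'²)` of `σ = log (|a|² + |b|²)`, where the derivatives are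
holomorphic ones, in terms of the `2`-jet of a holomorphic spinor `(a, b)`. -/
def spinorSchwarzian (a b a₁ b₁ a₂ b₂ : ℂ) : ℂ :=
  2 * ((a₂ * conj a + b₂ * conj b) / spinorNormSq a b -
    2 * ((a₁ * conj a + b₁ * conj b) / spinorNormSq a b) ^ 2)

/-- The Wronskian of a spinor divided by its squared length. Its squared modulus is a quarter of
the conformally weighted Gauss curvature, up to sign. -/
def spinorWronskian (a b a₁ b₁ : ℂ) : ℂ := (a * b₁ - a₁ * b) / spinorNormSq a b

theorem spinorNormSq_pos {a b : ℂ} (h : a ≠ 0 ∨ b ≠ 0) : 0 < spinorNormSq a b := by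
  rcases h with h | h
  · exact add_pos_of_pos_of_nonneg (Complex.normSq_pos.2 h) (Complex.normSq_nonneg _)
  · exact add_pos_of_nonneg_of_pos (Complex.normSq_nonneg _) (Complex.normSq_pos.2 h)

theorem norm_spinorVec (a b : ℂ) : ‖spinorVec a b‖ = spinorNormSq a b := by
  have h0 : 0 ≤ spinorNormSq a b := add_nonneg (Complex.normSq_nonneg _) (Complex.normSq_nonneg _)
  rw [EuclideanSpace.norm_eq, Real.sqrt_eq_iff_mul_self_eq (by positivity) h0]
  simp [Fin.sum_univ_three, spinorVec, spinorNormSq, Complex.normSq_apply, pow_two]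
  ring

theorem hasDerivAt_euclidean_three {f₁ f₂ f₃ : ℝ → ℝ} {d₁ d₂ d₃ x : ℝ} (h₁ : HasDerivAt f₁ d₁ x)
    (h₂ : HasDerivAt f₂ d₂ x) (h₃ : HasDerivAt f₃ d₃ x) :
    HasDerivAt (fun y => (!₂[f₁ y, f₂ y, f₃ y] : EuclideanSpace ℝ (Fin 3))) !₂[d₁, d₂, d₃] x := by
  have h : HasDerivAt (fun y => (![f₁ y, f₂ y, f₃ y] : Fin 3 → ℝ)) ![d₁, d₂, d₃] x := by
    rw [hasDerivAt_pi]
    intro i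
    fin_cases i
    exacts [h₁, h₂, h₃]
  exact ((PiLp.continuousLinearEquiv 2 ℝ fun _ : Fin 3 => ℝ).symm.toContinuousLinearMap
    |>.hasFDerivAt.comp_hasDerivAt x h)

theorem hasDerivAt_re {f : ℝ → ℂ} {d : ℂ} {x : ℝ} (h : HasDerivAt f d x) :
    HasDerivAt (fun y => (f y).re) d.re x :=
  Complex.reCLM.hasFDerivAt.comp_hasDerivAt x h

theorem hasDerivAt_im {f : ℝ → ℂ} {d : ℂ} {x : ℝ} (h : HasDerivAt f d x) :
    HasDerivAt (fun y => (f y).im) d.im x :=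
  Complex.imCLM.hasFDerivAt.comp_hasDerivAt x h

theorem hasDerivAt_conj {f : ℝ → ℂ} {d : ℂ} {x : ℝ} (h : HasDerivAt f d x) :
    HasDerivAt (fun y => conj (f y)) (conj d) x :=
  Complex.conjCLE.toContinuousLinearMap.hasFDerivAt.comp_hasDerivAt x h

theorem hasDerivAt_spinorNormSq {A B : ℝ → ℂ} {a₁ b₁ : ℂ} {x : ℝ} (hA : HasDerivAt A a₁ x)
    (hB : HasDerivAt B b₁ x) : HasDerivAt (fun y => spinorNormSq (A y) (B y))
      (2 * (a₁ * conj (A x) + b₁ * conj (B x)).re) x := by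
  have h := hasDerivAt_re ((hA.mul (hasDerivAt_conj hA)).add (hB.mul (hasDerivAt_conj hB)))
  refine (h.congr_of_eventuallyEq (Eventually.of_forall fun y => ?_)).congr_deriv ?_
  · simp [spinorNormSq, Complex.mul_conj]
  · simp
    ring

theorem hasDerivAt_spinorVec {A B : ℝ → ℂ} {a₁ b₁ : ℂ} {x : ℝ} (hA : HasDerivAt A a₁ x)
    (hB : HasDerivAt B b₁ x) : HasDerivAt (fun y => spinorVec (A y) (B y))
      !₂[(2 * A x * a₁ + 2 * B x * b₁).re, (2 * A x * a₁ - 2 * B x * b₁).im,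
        2 * (a₁ * B x + A x * b₁).im] x := by
  refine hasDerivAt_euclidean_three ?_ ?_ ?_
  · exact (hasDerivAt_re ((hA.pow 2).add (hB.pow 2))).congr_deriv (by simp)
  · exact (hasDerivAt_im ((hA.pow 2).sub (hB.pow 2))).congr_deriv (by simp)
  · exact (hasDerivAt_im (hA.mul hB)).const_mul 2

/-- The velocity of the spinor, written in the unitary frame `(a, b)`, `(-b̄, ā)`. -/
theorem spinor_frame {a b a₁ b₁ : ℂ} (h : a ≠ 0 ∨ b ≠ 0) :
    a₁ = (a₁ * conj a + b₁ * conj b) / spinorNormSq a b * a - spinorWronskian a b a₁ b₁ * conj b ∧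
    b₁ = (a₁ * conj a + b₁ * conj b) / spinorNormSq a b * b +
      spinorWronskian a b a₁ b₁ * conj a := by
  have h0 : (spinorNormSq a b : ℂ) ≠ 0 := by exact_mod_cast (spinorNormSq_pos h).ne'
  have h1 : (spinorNormSq a b : ℂ) = a * conj a + b * conj b := by
    simp [spinorNormSq, Complex.mul_conj]
  constructor <;>
  · rw [spinorWronskian]
    field_simp
    rw [h1]
    ring

/-- The curvature part of the acceleration when the spinor moves with velocity
`α (a, b) + β (-b̄, ā)`. -/
theorem norm_sq_spinorVec_deriv_sub (a b α β : ℂ) :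
    ‖(!₂[(2 * a * (α * a - β * conj b) + 2 * b * (α * b + β * conj a)).re,
        (2 * a * (α * a - β * conj b) - 2 * b * (α * b + β * conj a)).im,
        2 * ((α * a - β * conj b) * b + a * (α * b + β * conj a)).im] :
          EuclideanSpace ℝ (Fin 3)) - (2 * α.re) • spinorVec a b‖ ^ 2 =
      4 * spinorNormSq a b ^ 2 * (α.im ^ 2 + β.im ^ 2) := by
  rw [EuclideanSpace.norm_sq_eq]
  simp [Fin.sum_univ_three, spinorVec, spinorNormSq, Complex.normSq_apply, pow_two]
  ring

/-- The Ahlfors Schwarzian of a curve whose velocity is the real part of the isotropic vector of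
`(A, B)` is at most `|S| + 4 |β|²`. -/
theorem spinor_curve {A B A₁ B₁ : ℝ → ℂ} {A₂ B₂ : ℂ} {x : ℝ}
    (hA : ∀ᶠ y in 𝓝 x, HasDerivAt A (A₁ y) y) (hB : ∀ᶠ y in 𝓝 x, HasDerivAt B (B₁ y) y)
    (hA₁ : HasDerivAt A₁ A₂ x) (hB₁ : HasDerivAt B₁ B₂ x) (h0 : A x ≠ 0 ∨ B x ≠ 0) {τ : ℝ → ℝ}
    {ψ : ℝ → EuclideanSpace ℝ (Fin 3)}
    (hτ : τ =ᶠ[𝓝 x] fun y => Real.log (spinorNormSq (A y) (B y)))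
    (hψ : ψ =ᶠ[𝓝 x] fun y => spinorVec (A y) (B y)) :
    DifferentiableAt ℝ τ x ∧ DifferentiableAt ℝ (deriv τ) x ∧ DifferentiableAt ℝ ψ x ∧
    ‖ψ x‖ = Real.exp (τ x) ∧
    deriv (deriv τ) x - deriv τ x ^ 2 / 2 +
      ‖deriv ψ x - deriv τ x • ψ x‖ ^ 2 / (2 * Real.exp (τ x) ^ 2) ≤
      ‖spinorSchwarzian (A x) (B x) (A₁ x) (B₁ x) A₂ B₂‖ +
        4 * ‖spinorWronskian (A x) (B x) (A₁ x) (B₁ x)‖ ^ 2 := by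
  have hpos := spinorNormSq_pos h0
  have hc : ContinuousAt (fun y => spinorNormSq (A y) (B y)) x :=
    (hasDerivAt_spinorNormSq hA.self_of_nhds hB.self_of_nhds).continuousAt
  have hev : ∀ᶠ y in 𝓝 x, HasDerivAt τ
      (2 * (A₁ y * conj (A y) + B₁ y * conj (B y)).re / spinorNormSq (A y) (B y)) y := by
    filter_upwards [hA, hB, hτ.eventuallyEq_nhds, hc.eventually_ne hpos.ne'] with y h1 h2 h3 h4
    exact ((hasDerivAt_spinorNormSq h1 h2).log h4).congr_of_eventuallyEq h3
  have hdτ : deriv τ =ᶠ[𝓝 x] fun y =>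
      2 * (A₁ y * conj (A y) + B₁ y * conj (B y)).re / spinorNormSq (A y) (B y) :=
    hev.mono fun y hy => hy.deriv
  have hAx := hA.self_of_nhds
  have hBx := hB.self_of_nhds
  have hd2 := ((((hasDerivAt_re ((hA₁.mul (hasDerivAt_conj hAx)).add
    (hB₁.mul (hasDerivAt_conj hBx)))).const_mul 2).div
    (hasDerivAt_spinorNormSq hAx hBx) hpos.ne').congr_of_eventuallyEq hdτ)
  have hdψ := (hasDerivAt_spinorVec hAx hBx).congr_of_eventuallyEq hψ
  have hexp : Real.exp (τ x) = spinorNormSq (A x) (B x) := by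
    rw [hτ.self_of_nhds, Real.exp_log hpos]
  refine ⟨hev.self_of_nhds.differentiableAt, hd2.differentiableAt, hdψ.differentiableAt, ?_, ?_⟩
  · rw [hψ.self_of_nhds, hexp, norm_spinorVec]
  obtain ⟨hf1, hf2⟩ := spinor_frame (a₁ := A₁ x) (b₁ := B₁ x) h0
  rw [hd2.deriv, hdτ.self_of_nhds, hdψ.deriv, hexp, hψ.self_of_nhds]
  have hS : (spinorSchwarzian (A x) (B x) (A₁ x) (B₁ x) A₂ B₂).re ≤
      ‖spinorSchwarzian (A x) (B x) (A₁ x) (B₁ x) A₂ B₂‖ := Complex.re_le_norm _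
  rw [spinorSchwarzian] at hS ⊢
  set α := (A₁ x * conj (A x) + B₁ x * conj (B x)) / (spinorNormSq (A x) (B x) : ℂ) with hα
  set β := spinorWronskian (A x) (B x) (A₁ x) (B₁ x)
  set l := spinorNormSq (A x) (B x) with hl
  have hl' : l = Complex.normSq (A x) + Complex.normSq (B x) := rfl
  have hαre : 2 * (A₁ x * conj (A x) + B₁ x * conj (B x)).re / l = 2 * α.re := by
    rw [hα, Complex.div_ofReal_re]; ring
  have hn : Complex.normSq (A₁ x) + Complex.normSq (B₁ x) =
      l * (Complex.normSq α + Complex.normSq β) := by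
    rw [hf1, hf2, hl']
    simp only [Complex.normSq_apply, Complex.sub_re, Complex.sub_im, Complex.add_re,
      Complex.add_im, Complex.mul_re, Complex.mul_im, Complex.conj_re, Complex.conj_im]
    ring
  have hk : ‖(!₂[(2 * A x * A₁ x + 2 * B x * B₁ x).re, (2 * A x * A₁ x - 2 * B x * B₁ x).im,
        2 * (A₁ x * B x + A x * B₁ x).im] : EuclideanSpace ℝ (Fin 3)) -
        (2 * α.re) • spinorVec (A x) (B x)‖ ^ 2 = 4 * l ^ 2 * (α.im ^ 2 + β.im ^ 2) := by
    rw [hf1, hf2]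
    exact norm_sq_spinorVec_deriv_sub _ _ α β
  have hre : (A₁ x * conj (A x) + B₁ x * conj (B x)).re = l * α.re := by
    rw [eq_comm, ← mul_div_cancel_left₀ (l * α.re) (two_ne_zero (α := ℝ))]
    have := (div_eq_iff hpos.ne').1 hαre
    linarith
  have hβ : ‖β‖ ^ 2 = β.re ^ 2 + β.im ^ 2 := by
    rw [← Complex.normSq_eq_norm_sq, Complex.normSq_apply]; ring
  simp only [Pi.add_apply, Pi.mul_apply]
  rw [hαre, hk, hβ, hre]
  set Γ := (A₂ * conj (A x) + B₂ * conj (B x)) / (l : ℂ) with hΓ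
  have hΓre : (A₂ * conj (A x) + A₁ x * conj (A₁ x) + (B₂ * conj (B x) + B₁ x * conj (B₁ x))).re =
      l * Γ.re + l * (Complex.normSq α + Complex.normSq β) := by
    rw [← hn, hΓ, Complex.div_ofReal_re, mul_div_cancel₀ _ hpos.ne', Complex.mul_conj,
      Complex.mul_conj]
    simp only [Complex.add_re, Complex.ofReal_re]
    ring
  have hSre : (2 * (Γ - 2 * α ^ 2)).re = 2 * Γ.re - 4 * (α.re ^ 2 - α.im ^ 2) := by
    simp [pow_two]
    ring
  rw [hΓre, Complex.normSq_apply, Complex.normSq_apply]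
  rw [hSre] at hS
  have hval : (2 * (l * Γ.re + l * (α.re * α.re + α.im * α.im + (β.re * β.re + β.im * β.im))) * l -
      2 * (l * α.re) * (2 * (l * α.re))) / l ^ 2 - (2 * α.re) ^ 2 / 2 +
      4 * l ^ 2 * (α.im ^ 2 + β.im ^ 2) / (2 * l ^ 2) =
      2 * Γ.re - 4 * (α.re ^ 2 - α.im ^ 2) + 2 * β.re ^ 2 + 4 * β.im ^ 2 := by
    field_simp
    ring
  rw [hval]
  nlinarith [sq_nonneg β.re]

/-! ### Schwarzian and curvature of a spinor -/

/-- The real-linear map `v ↦ α v + β v̄`, the differential of a function with Wirtinger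
derivatives `α` and `β`. -/
def wirtinger (α β : ℂ) : ℂ →L[ℝ] ℂ :=
  α • ContinuousLinearMap.id ℝ ℂ + β • Complex.conjCLE.toContinuousLinearMap

@[simp]
theorem wirtinger_apply (α β v : ℂ) : wirtinger α β v = α * v + β * conj v := by
  simp [wirtinger]

theorem dz_eq {s : ℂ → ℂ} {α β z : ℂ} (h : HasFDerivAt s (wirtinger α β) z) : dz s z = α := by
  rw [dz, h.fderiv]
  simp only [wirtinger_apply, map_one, Complex.conj_I]
  linear_combination (-(α - β) / 2) * Complex.I_mul_I

/-- The real-linear form `v ↦ 2 Re (c v)`, the differential of a real function whose derivative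
`∂/∂z` is `c`. It depends real-linearly on `c`. -/
def twoReMul : ℂ →L[ℝ] ℂ →L[ℝ] ℝ :=
  (2 : ℝ) • (ContinuousLinearMap.compL ℝ ℂ ℂ ℝ Complex.reCLM).comp (ContinuousLinearMap.mul ℝ ℂ)

@[simp]
theorem twoReMul_apply (c v : ℂ) : twoReMul c v = 2 * (c * v).re := by
  simp [twoReMul]

theorem hasFDerivAt_wirtinger_of_hasDerivAt {a : ℂ → ℂ} {a₁ z : ℂ} (h : HasDerivAt a a₁ z) :
    HasFDerivAt a (wirtinger a₁ 0) z := by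
  refine (h.hasFDerivAt.restrictScalars ℝ).congr_fderiv ?_
  refine ContinuousLinearMap.ext fun v => ?_
  simp [mul_comm]

theorem hasFDerivAt_wirtinger_conj {a : ℂ → ℂ} {a₁ z : ℂ} (h : HasDerivAt a a₁ z) :
    HasFDerivAt (fun w => conj (a w)) (wirtinger 0 (conj a₁)) z := by
  refine (Complex.conjCLE.toContinuousLinearMap.hasFDerivAt.comp z
    (h.hasFDerivAt.restrictScalars ℝ)).congr_fderiv ?_
  refine ContinuousLinearMap.ext fun v => ?_
  simp [mul_comm]

theorem hasFDerivAt_wirtinger_mul {s t : ℂ → ℂ} {α β γ δ z : ℂ}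
    (hs : HasFDerivAt s (wirtinger α β) z) (ht : HasFDerivAt t (wirtinger γ δ) z) :
    HasFDerivAt (fun w => s w * t w) (wirtinger (α * t z + s z * γ) (β * t z + s z * δ)) z := by
  refine (hs.mul ht).congr_fderiv ?_
  refine ContinuousLinearMap.ext fun v => ?_
  simp
  ring

theorem hasFDerivAt_wirtinger_add {s t : ℂ → ℂ} {α β γ δ z : ℂ}
    (hs : HasFDerivAt s (wirtinger α β) z) (ht : HasFDerivAt t (wirtinger γ δ) z) :
    HasFDerivAt (fun w => s w + t w) (wirtinger (α + γ) (β + δ)) z := by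
  refine (hs.add ht).congr_fderiv ?_
  refine ContinuousLinearMap.ext fun v => ?_
  simp
  ring

theorem hasFDerivAt_wirtinger_inv {s : ℂ → ℂ} {α β z : ℂ}
    (hs : HasFDerivAt s (wirtinger α β) z) (h0 : s z ≠ 0) :
    HasFDerivAt (fun w => (s w)⁻¹) (wirtinger (-(α / s z ^ 2)) (-(β / s z ^ 2))) z := by
  refine (((hasDerivAt_inv h0).hasFDerivAt.restrictScalars ℝ).comp z hs).congr_fderiv ?_
  refine ContinuousLinearMap.ext fun v => ?_
  simp
  field_simp
  ring

theorem ofReal_spinorNormSq (a b : ℂ) : (spinorNormSq a b : ℂ) = a * conj a + b * conj b := by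
  simp [spinorNormSq, Complex.mul_conj]

theorem hasFDerivAt_spinorNormSq_ofReal {a b : ℂ → ℂ} {a₁ b₁ z : ℂ} (ha : HasDerivAt a a₁ z)
    (hb : HasDerivAt b b₁ z) : HasFDerivAt (fun w => (spinorNormSq (a w) (b w) : ℂ))
      (wirtinger (a₁ * conj (a z) + b₁ * conj (b z))
        (conj (a₁ * conj (a z) + b₁ * conj (b z)))) z := by
  have h := hasFDerivAt_wirtinger_add
    (hasFDerivAt_wirtinger_mul (hasFDerivAt_wirtinger_of_hasDerivAt ha)
      (hasFDerivAt_wirtinger_conj ha))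
    (hasFDerivAt_wirtinger_mul (hasFDerivAt_wirtinger_of_hasDerivAt hb)
      (hasFDerivAt_wirtinger_conj hb))
  simp only [← ofReal_spinorNormSq] at h
  refine h.congr_fderiv ?_
  congr 1 <;> simp [mul_comm]

theorem hasFDerivAt_log_spinorNormSq {a b : ℂ → ℂ} {a₁ b₁ z : ℂ} (ha : HasDerivAt a a₁ z)
    (hb : HasDerivAt b b₁ z) (h0 : a z ≠ 0 ∨ b z ≠ 0) :
    HasFDerivAt (fun w => Real.log (spinorNormSq (a w) (b w)))
      (twoReMul ((a₁ * conj (a z) + b₁ * conj (b z)) / spinorNormSq (a z) (b z))) z := by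
  have h := (Complex.reCLM.hasFDerivAt.comp z (hasFDerivAt_spinorNormSq_ofReal ha hb)).log
    (by simpa using (spinorNormSq_pos h0).ne')
  refine h.congr_fderiv (ContinuousLinearMap.ext fun v => ?_)
  simp only [Function.comp_apply, Complex.reCLM_apply, Complex.ofReal_re, smul_eq_mul,
    smul_apply, ContinuousLinearMap.comp_apply, wirtinger_apply,
    twoReMul_apply]
  rw [← map_mul, Complex.add_conj, div_mul_eq_mul_div, Complex.div_ofReal_re, Complex.ofReal_re]
  ring

/-- Lagrange's identity; the left-hand side is `∂²σ/∂z∂z̄` for `σ = log (|a|² + |b|²)`. -/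
theorem normSq_spinorWronskian {a b a₁ b₁ : ℂ} (h0 : a ≠ 0 ∨ b ≠ 0) :
    (Complex.normSq a₁ + Complex.normSq b₁) / spinorNormSq a b -
      Complex.normSq ((a₁ * conj a + b₁ * conj b) / spinorNormSq a b) =
      ‖spinorWronskian a b a₁ b₁‖ ^ 2 := by
  have hpos := spinorNormSq_pos h0
  rw [← Complex.normSq_eq_norm_sq, spinorWronskian, Complex.normSq_div, Complex.normSq_div,
    Complex.normSq_ofReal]
  field_simp
  simp only [spinorNormSq, Complex.normSq_apply, Complex.sub_re, Complex.sub_im, Complex.add_re,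
      Complex.add_im, Complex.mul_re, Complex.mul_im, Complex.conj_re, Complex.conj_im]
  ring

/-- The Schwarzian and the Gauss curvature in terms of a local holomorphic spinor. -/
theorem schwarzian_gaussCurvature_eq {h g a b a₁ b₁ : ℂ → ℂ} {a₂ b₂ z : ℂ}
    (ha : ∀ᶠ w in 𝓝 z, HasDerivAt a (a₁ w) w) (hb : ∀ᶠ w in 𝓝 z, HasDerivAt b (b₁ w) w)
    (ha₁ : HasDerivAt a₁ a₂ z) (hb₁ : HasDerivAt b₁ b₂ z) (h0 : a z ≠ 0 ∨ b z ≠ 0)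
    (hl : ∀ᶠ w in 𝓝 z, conformalFactor h g w = spinorNormSq (a w) (b w)) :
    schwarzian h g z = spinorSchwarzian (a z) (b z) (a₁ z) (b₁ z) a₂ b₂ ∧
    conformalFactor h g z ^ 2 * |gaussCurvature h g z| =
      4 * ‖spinorWronskian (a z) (b z) (a₁ z) (b₁ z)‖ ^ 2 := by
  have hpos := spinorNormSq_pos h0
  have haz := ha.self_of_nhds
  have hbz := hb.self_of_nhds
  set c : ℂ → ℂ := fun w =>
    (a₁ w * conj (a w) + b₁ w * conj (b w)) / spinorNormSq (a w) (b w) with hc_def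
  have hne : ∀ᶠ w in 𝓝 z, a w ≠ 0 ∨ b w ≠ 0 := by
    rcases h0 with h | h
    · exact (haz.continuousAt.eventually_ne h).mono fun _ => Or.inl
    · exact (hbz.continuousAt.eventually_ne h).mono fun _ => Or.inr
  have hσ : ∀ᶠ w in 𝓝 z, HasFDerivAt (sigma h g) (twoReMul (c w)) w := by
    filter_upwards [ha, hb, hne, hl.eventually_nhds] with w h1 h2 h3 h4
    exact (hasFDerivAt_log_spinorNormSq h1 h2 h3).congr_of_eventuallyEq
      (h4.mono fun y hy => by rw [sigma, hy])
  have hdz : dz (fun w => (sigma h g w : ℂ)) =ᶠ[𝓝 z] c := by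
    filter_upwards [hσ] with w hw
    refine dz_eq (β := conj (c w)) ((Complex.ofRealCLM.hasFDerivAt.comp w hw).congr_fderiv
      (ContinuousLinearMap.ext fun v => ?_))
    simp only [ContinuousLinearMap.comp_apply, twoReMul_apply, Complex.ofRealCLM_apply,
      wirtinger_apply]
    rw [← map_mul, Complex.add_conj]
  -- the two Wirtinger derivatives of `∂σ/∂z`
  have hc : HasFDerivAt c (wirtinger
      ((a₂ * conj (a z) + b₂ * conj (b z)) / spinorNormSq (a z) (b z) - c z ^ 2)
      ((‖spinorWronskian (a z) (b z) (a₁ z) (b₁ z)‖ ^ 2 : ℝ) : ℂ)) z := by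
    have h1 := hasFDerivAt_wirtinger_mul (hasFDerivAt_wirtinger_add
      (hasFDerivAt_wirtinger_mul (hasFDerivAt_wirtinger_of_hasDerivAt ha₁)
        (hasFDerivAt_wirtinger_conj haz))
      (hasFDerivAt_wirtinger_mul (hasFDerivAt_wirtinger_of_hasDerivAt hb₁)
        (hasFDerivAt_wirtinger_conj hbz)))
      (hasFDerivAt_wirtinger_inv (hasFDerivAt_spinorNormSq_ofReal haz hbz)
        (by exact_mod_cast hpos.ne'))
    have hposC : (spinorNormSq (a z) (b z) : ℂ) ≠ 0 := by exact_mod_cast hpos.ne'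
    refine h1.congr_fderiv ?_
    rw [← normSq_spinorWronskian h0]
    push_cast
    rw [← Complex.mul_conj, ← Complex.mul_conj, ← Complex.mul_conj, hc_def]
    simp only [map_div₀, Complex.conj_ofReal]
    congr 1 <;> field_simp <;> ring
  have hschw : schwarzian h g z = spinorSchwarzian (a z) (b z) (a₁ z) (b₁ z) a₂ b₂ := by
    have h2 : dz (dz fun w => (sigma h g w : ℂ)) z = _ := dz_eq (hc.congr_of_eventuallyEq hdz)
    rw [schwarzian, h2, hdz.self_of_nhds, spinorSchwarzian]
    ring
  refine ⟨hschw, ?_⟩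
  have hfd : fderiv ℝ (sigma h g) =ᶠ[𝓝 z] fun w => twoReMul (c w) := hσ.mono fun w hw => hw.fderiv
  have hfd2 := (twoReMul.hasFDerivAt.comp z hc).congr_of_eventuallyEq hfd
  have hlap : Laplacian.laplacian (sigma h g) z =
      4 * ‖spinorWronskian (a z) (b z) (a₁ z) (b₁ z)‖ ^ 2 := by
    obtain ⟨κ, hκ⟩ : ∃ κ, κ = ‖spinorWronskian (a z) (b z) (a₁ z) (b₁ z)‖ ^ 2 := ⟨_, rfl⟩
    rw [← hκ] at hfd2 ⊢
    rw [InnerProductSpace.laplacian_eq_iteratedFDeriv_complexPlane]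
    simp only [iteratedFDeriv_two_apply, hfd2.fderiv]
    simp
    ring
  rw [gaussCurvature, hlap, hl.self_of_nhds, neg_mul, abs_neg, abs_of_nonneg (by positivity)]
  field_simp

/-! ### Geodesics of the disk -/

/-- The Möbius self-map `ζ ↦ ω (ζ + i t) / (1 - i t ζ)` of the disk, for `|ω| = 1` and
`-1 < t < 1`. It maps the diameter `(-1, 1)` onto the hyperbolic geodesic whose point closest to
the origin is `i ω t`, the image of `0`. -/
def geodesicMap (ω : ℂ) (t : ℝ) (ζ : ℂ) : ℂ := ω * ((ζ + Complex.I * t) / (1 - Complex.I * t * ζ))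

theorem one_sub_I_mul_ne_zero (t x : ℝ) : 1 - Complex.I * t * x ≠ 0 := by
  intro h
  have := congrArg Complex.re h
  simp at this

theorem normSq_one_sub_I_mul (t x : ℝ) :
    Complex.normSq (1 - Complex.I * t * x) = 1 + t ^ 2 * x ^ 2 := by
  simp [Complex.normSq_apply]
  ring

theorem hasDerivAt_geodesicMap (ω : ℂ) (t : ℝ) {ζ : ℂ} (h : 1 - Complex.I * t * ζ ≠ 0) :
    HasDerivAt (geodesicMap ω t) (ω * ((1 - t ^ 2) / (1 - Complex.I * t * ζ) ^ 2)) ζ := by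
  have h1 := (((hasDerivAt_id ζ).add_const (Complex.I * t)).div
    (((hasDerivAt_id ζ).const_mul (Complex.I * t)).const_sub 1) h).const_mul ω
  refine h1.congr_deriv ?_
  simp only [id]
  congr 2
  linear_combination ((t : ℂ) ^ 2) * Complex.I_mul_I

theorem one_sub_norm_geodesicMap_sq {ω : ℂ} (hω : ‖ω‖ = 1) (t x : ℝ) :
    1 - ‖geodesicMap ω t x‖ ^ 2 = (1 - x ^ 2) * ((1 - t ^ 2) / (1 + t ^ 2 * x ^ 2)) := by
  rw [geodesicMap, norm_mul, hω, one_mul, ← Complex.normSq_eq_norm_sq, Complex.normSq_div,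
    normSq_one_sub_I_mul]
  have h : Complex.normSq (x + Complex.I * t) = x ^ 2 + t ^ 2 := by
    simp [Complex.normSq_apply]
    ring
  have h1 : 0 < 1 + t ^ 2 * x ^ 2 := by positivity
  rw [h]
  field_simp
  ring

theorem geodesicMap_mem_disk {ω : ℂ} (hω : ‖ω‖ = 1) {t x : ℝ} (ht : |t| < 1)
    (hx : x ∈ Ioo (-1 : ℝ) 1) : geodesicMap ω t x ∈ disk := by
  have ht2 : 0 < 1 - t ^ 2 := by
    have := (sq_lt_one_iff_abs_lt_one t).2 ht
    linarith
  have h : 0 < 1 - ‖geodesicMap ω t x‖ ^ 2 := by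
    rw [one_sub_norm_geodesicMap_sq hω]
    have := one_sub_sq_pos hx
    positivity
  rw [disk, mem_ball_zero_iff]
  nlinarith [norm_nonneg (geodesicMap ω t x)]

/-- Points of the geodesic are at least as far from the origin as the corresponding points of the
diameter. -/
theorem abs_le_norm_geodesicMap {ω : ℂ} (hω : ‖ω‖ = 1) {t x : ℝ} (hx : x ∈ Ioo (-1 : ℝ) 1) :
    |x| ≤ ‖geodesicMap ω t x‖ := by
  refine abs_le_of_sq_le_sq' ?_ (norm_nonneg _) |> abs_le.2
  have h := one_sub_norm_geodesicMap_sq hω t x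
  have h1 : (1 - t ^ 2) / (1 + t ^ 2 * x ^ 2) ≤ 1 := by
    rw [div_le_one (by positivity)]
    nlinarith [sq_nonneg t, mul_nonneg (sq_nonneg t) (sq_nonneg x)]
  nlinarith [one_sub_sq_pos hx]

theorem norm_deriv_geodesicMap {ω : ℂ} (hω : ‖ω‖ = 1) {t x : ℝ} (ht : |t| < 1)
    (hx : x ∈ Ioo (-1 : ℝ) 1) : ‖ω * ((1 - (t : ℂ) ^ 2) / (1 - Complex.I * t * x) ^ 2)‖ =
      (1 - ‖geodesicMap ω t x‖ ^ 2) / (1 - x ^ 2) := by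
  have ht2 : 0 ≤ 1 - t ^ 2 := by
    have := (sq_lt_one_iff_abs_lt_one t).2 ht
    linarith
  rw [one_sub_norm_geodesicMap_sq hω, mul_div_cancel_left₀ _ (one_sub_sq_pos hx).ne', norm_mul, hω,
    one_mul, norm_div, norm_pow, ← Complex.normSq_eq_norm_sq, normSq_one_sub_I_mul]
  congr 1
  rw [show (1 : ℂ) - (t : ℂ) ^ 2 = ((1 - t ^ 2 : ℝ) : ℂ) by push_cast; rfl, Complex.norm_real,
    Real.norm_of_nonneg ht2]

/-- Any two points of the disk lie on a common geodesic. In the Klein model `z ↦ 2 z / (1 + |z|²)`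
geodesics are chords, so `ω` is the direction of the chord through the two points. -/
theorem exists_geodesicMap_eq {z₁ z₂ : ℂ} (h₁ : z₁ ∈ disk) (h₂ : z₂ ∈ disk) :
    ∃ ω : ℂ, ‖ω‖ = 1 ∧ ∃ t : ℝ, |t| < 1 ∧ ∃ x₁ ∈ Ioo (-1 : ℝ) 1, ∃ x₂ ∈ Ioo (-1 : ℝ) 1,
      geodesicMap ω t x₁ = z₁ ∧ geodesicMap ω t x₂ = z₂ := by
  rw [disk, mem_ball_zero_iff] at h₁ h₂
  set Z : ℂ → ℂ := fun z => ((2 / (1 + ‖z‖ ^ 2) : ℝ) : ℂ) * z with hZ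
  obtain ⟨ω, hω, hIm⟩ : ∃ ω : ℂ, ‖ω‖ = 1 ∧ (conj ω * Z z₁).im = (conj ω * Z z₂).im := by
    rcases eq_or_ne (Z z₁) (Z z₂) with h | h
    · exact ⟨1, norm_one, by rw [h]⟩
    · have hn : ‖Z z₁ - Z z₂‖ ≠ 0 := norm_ne_zero_iff.2 (sub_ne_zero.2 h)
      refine ⟨(Z z₁ - Z z₂) / ‖Z z₁ - Z z₂‖, ?_, ?_⟩
      · rw [norm_div, Complex.norm_real, norm_norm, div_self hn]
      · rw [← sub_eq_zero, ← Complex.sub_im, ← mul_sub, map_div₀, Complex.conj_ofReal,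
          div_mul_eq_mul_div, mul_comm, Complex.mul_conj, ← Complex.ofReal_div, Complex.ofReal_im]
  set τ := (conj ω * Z z₁).im with hτ
  have hconj : ‖conj ω‖ = 1 := by rw [Complex.norm_conj, hω]
  have hτ1 : |τ| < 1 := by
    refine (Complex.abs_im_le_norm _).trans_lt ?_
    rw [norm_mul, hconj, one_mul, hZ, norm_mul, Complex.norm_real, Real.norm_of_nonneg
      (by positivity), div_mul_eq_mul_div, div_lt_one (by positivity)]
    nlinarith [sq_pos_of_pos (sub_pos.2 h₁)]
  have hτ2 : 0 < 1 - τ ^ 2 := by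
    have := (sq_lt_one_iff_abs_lt_one τ).2 hτ1
    linarith
  -- `t` solves `2 t / (1 + t²) = τ`
  set s := √(1 - τ ^ 2) with hs
  have hs0 : 0 < s := Real.sqrt_pos.2 hτ2
  have hs2 : s ^ 2 = 1 - τ ^ 2 := Real.sq_sqrt hτ2.le
  set t := τ / (1 + s) with ht
  have ht_mul : t * (1 + s) = τ := by rw [ht]; field_simp
  have htabs : |t| < 1 := by
    rw [ht, abs_div, abs_of_pos (by positivity : 0 < 1 + s), div_lt_one (by positivity)]
    linarith
  have ht_eq : 2 * t = τ * (1 + t ^ 2) := by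
    have : (1 + s) ^ 2 * (2 * t - τ * (1 + t ^ 2)) = 0 := by
      rw [← ht_mul]
      have h3 : t ^ 2 * (1 + s) ^ 2 = τ ^ 2 := by rw [← mul_pow, ht_mul]
      have h4 : s ^ 2 = 1 - t ^ 2 * (1 + s) ^ 2 := by rw [h3, hs2]
      linear_combination (-(t * (1 + s))) * h4
    rcases mul_eq_zero.1 this with h | h
    · nlinarith
    · linarith
  have key : ∀ z : ℂ, ‖z‖ < 1 → (conj ω * Z z).im = τ →
      ∃ x ∈ Ioo (-1 : ℝ) 1, geodesicMap ω t x = z := by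
    intro z hz hzτ
    set ζ := conj ω * z with hζ
    have hζω : ω * ζ = z := by
      rw [hζ, ← mul_assoc, Complex.mul_conj, Complex.normSq_eq_norm_sq, hω]
      simp
    have hζn : ‖ζ‖ = ‖z‖ := by rw [hζ, norm_mul, hconj, one_mul]
    have hn : ‖z‖ ^ 2 = ζ.re ^ 2 + ζ.im ^ 2 := by
      rw [← hζn, ← Complex.normSq_eq_norm_sq, Complex.normSq_apply]; ring
    have h1 : 2 * ζ.im = τ * (1 + ‖z‖ ^ 2) := by
      have h2 : conj ω * Z z = ((2 / (1 + ‖z‖ ^ 2) : ℝ) : ℂ) * ζ := by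
        rw [hZ, hζ]; ring
      rwa [h2, Complex.im_ofReal_mul, div_mul_eq_mul_div, div_eq_iff (by positivity)] at hzτ
    have h3 : ζ.im * (1 + t ^ 2) = t * (1 + ‖z‖ ^ 2) := by
      linear_combination (1 + t ^ 2) / 2 * h1 - (1 + ‖z‖ ^ 2) / 2 * ht_eq
    have hvt : 0 < 1 - ζ.im * t := by
      have h4 : |ζ.im * t| < 1 := by
        rw [abs_mul]
        have := (Complex.abs_im_le_norm ζ).trans_lt (hζn ▸ hz)
        nlinarith [abs_nonneg ζ.im, abs_nonneg t]
      linarith [(abs_lt.1 h4).2]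
    -- the real solution of `(x + i t) / (1 - i t x) = ζ`
    set x := ζ.re / (1 - ζ.im * t) with hx
    have hx_mul : x * (1 - ζ.im * t) = ζ.re := by rw [hx]; field_simp
    have hmap : geodesicMap ω t x = z := by
      rw [geodesicMap, ← hζω]
      congr 1
      rw [div_eq_iff (one_sub_I_mul_ne_zero t x)]
      apply Complex.ext
      · simp
        linarith
      · simp
        refine mul_left_cancel₀ hvt.ne' ?_
        rw [hn] at h3
        linear_combination t * ζ.re * hx_mul - h3
    have hx1 : 0 < 1 - x ^ 2 := by
      have h5 := one_sub_norm_geodesicMap_sq hω t x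
      rw [hmap] at h5
      have h6 : 0 < 1 - ‖z‖ ^ 2 := by nlinarith [norm_nonneg z]
      rw [h5] at h6
      refine pos_of_mul_pos_left h6 (div_nonneg ?_ (by positivity))
      have := (sq_lt_one_iff_abs_lt_one t).2 htabs
      linarith
    exact ⟨x, abs_lt.1 ((sq_lt_one_iff_abs_lt_one x).1 (by linarith)), hmap⟩
  obtain ⟨x₁, hx₁, e₁⟩ := key z₁ h₁ rfl
  obtain ⟨x₂, hx₂, e₂⟩ := key z₂ h₂ hIm.symm
  exact ⟨ω, hω, t, htabs, x₁, hx₁, x₂, hx₂, e₁, e₂⟩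

theorem one_sub_mul_pos {x y : ℝ} (hx : x ∈ Ioo (-1 : ℝ) 1) (hy : y ∈ Ioo (-1 : ℝ) 1) :
    0 < 1 - x * y := by
  nlinarith [hx.1, hx.2, hy.1, hy.2]

theorem hypDist_geodesicMap {ω : ℂ} (hω : ‖ω‖ = 1) {t x y : ℝ} (ht : |t| < 1)
    (hx : x ∈ Ioo (-1 : ℝ) 1) (hy : y ∈ Ioo (-1 : ℝ) 1) :
    hypDist (geodesicMap ω t x) (geodesicMap ω t y) =
      Real.artanh (|x - y| / (1 - x * y)) := by
  have ht2 : 0 < 1 - t ^ 2 := by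
    have := (sq_lt_one_iff_abs_lt_one t).2 ht
    linarith
  have hdx := one_sub_I_mul_ne_zero t x
  have hdy := one_sub_I_mul_ne_zero t y
  have hcx : 1 + Complex.I * t * x ≠ 0 := by
    simpa using one_sub_I_mul_ne_zero (-t) x
  have h1 : geodesicMap ω t x - geodesicMap ω t y =
      ω * (((x - y) * (1 - t ^ 2) : ℝ) / ((1 - Complex.I * t * x) * (1 - Complex.I * t * y))) := by
    rw [geodesicMap, geodesicMap, ← mul_sub, div_sub_div _ _ hdx hdy]
    congr 2
    push_cast
    linear_combination ((t : ℂ) ^ 2 * (x - y)) * Complex.I_mul_I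
  have hωω : conj ω * ω = 1 := by
    rw [mul_comm, Complex.mul_conj, Complex.normSq_eq_norm_sq, hω]
    simp
  have h2 : 1 - conj (geodesicMap ω t x) * geodesicMap ω t y =
      ((1 - x * y) * (1 - t ^ 2) : ℝ) /
        ((1 + Complex.I * t * x) * (1 - Complex.I * t * y)) := by
    have h3 : conj (geodesicMap ω t x) =
        conj ω * ((x - Complex.I * t) / (1 + Complex.I * t * x)) := by
      simp [geodesicMap, sub_eq_add_neg]
    rw [h3, geodesicMap, mul_mul_mul_comm, hωω, one_mul, div_mul_div_comm,
      one_sub_div (mul_ne_zero hcx hdy)]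
    congr 1
    push_cast
    linear_combination ((t : ℂ) ^ 2 * (1 - x * y)) * Complex.I_mul_I
  have hn : ‖1 + Complex.I * t * x‖ = ‖1 - Complex.I * t * x‖ := by
    rw [← Complex.norm_conj]
    simp [sub_eq_add_neg]
  rw [hypDist, h1, h2, norm_mul, hω, one_mul, norm_div, norm_div, norm_mul, norm_mul, hn,
    Complex.norm_real, Complex.norm_real, Real.norm_eq_abs, Real.norm_eq_abs, abs_mul, abs_mul,
    abs_of_pos ht2, abs_of_pos (one_sub_mul_pos hx hy)]
  have hdx' : ‖1 - Complex.I * t * x‖ ≠ 0 := norm_ne_zero_iff.2 hdx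
  have hdy' : ‖1 - Complex.I * t * y‖ ≠ 0 := norm_ne_zero_iff.2 hdy
  have h1xy := (one_sub_mul_pos hx hy).ne'
  congr 1
  field_simp

theorem artanh_sub {x y : ℝ} (hx : x ∈ Ioo (-1 : ℝ) 1) (hy : y ∈ Ioo (-1 : ℝ) 1) :
    Real.artanh ((y - x) / (1 - x * y)) = Real.artanh y - Real.artanh x := by
  have h := one_sub_mul_pos hx hy
  have hmem : (y - x) / (1 - x * y) ∈ Icc (-1 : ℝ) 1 := by
    rw [mem_Icc, le_div_iff₀ h, div_le_iff₀ h]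
    constructor <;> nlinarith [hx.1, hx.2, hy.1, hy.2]
  have hx1 : 0 < 1 + x := by linarith [hx.1]
  have hx2 : 0 < 1 - x := by linarith [hx.2]
  have hy1 : 0 < 1 + y := by linarith [hy.1]
  have hy2 : 0 < 1 - y := by linarith [hy.2]
  rw [Real.artanh_eq_half_log hmem, Real.artanh_eq_half_log (Ioo_subset_Icc_self hx),
    Real.artanh_eq_half_log (Ioo_subset_Icc_self hy), ← mul_sub,
    ← Real.log_div (by positivity) (by positivity)]
  congr 2
  have h3 : 1 + (y - x) / (1 - x * y) = (1 + y) * (1 - x) / (1 - x * y) := by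
    rw [one_add_div h.ne']; ring
  have h4 : 1 - (y - x) / (1 - x * y) = (1 + x) * (1 - y) / (1 - x * y) := by
    rw [one_sub_div h.ne']; ring
  rw [h3, h4, div_div_div_cancel_right₀ h.ne', div_div_div_eq]
  ring

theorem hasDerivAt_artanh {x : ℝ} (hx : x ∈ Ioo (-1 : ℝ) 1) :
    HasDerivAt Real.artanh (1 / (1 - x ^ 2)) x := by
  have hx1 : 0 < 1 + x := by linarith [hx.1]
  have hx2 : 0 < 1 - x := by linarith [hx.2]
  have h := ((((hasDerivAt_id x).const_add 1).div ((hasDerivAt_id x).const_sub 1) hx2.ne').log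
    (div_pos hx1 hx2).ne').const_mul (1 / 2)
  refine (h.congr_of_eventuallyEq ?_).congr_deriv ?_
  · filter_upwards [isOpen_Ioo.mem_nhds hx] with y hy
    exact Real.artanh_eq_half_log (Ioo_subset_Icc_self hy)
  · have h3 : 1 - x ^ 2 ≠ 0 := (one_sub_sq_pos hx).ne'
    simp only [id, Pi.div_apply]
    field_simp
    ring

/-- Equivalently, `F'(x) ≥ 1 / (1 - x ^ 2)`. -/
theorem IsExtremalNehari.sq_le {p u : ℝ → ℝ} (hp : IsExtremalNehari p)
    (hu : IsSolution p u) (h0 : u 0 = 1) (h1 : deriv u 0 = 0) {x : ℝ} (hx : x ∈ Ioo (-1 : ℝ) 1) :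
    u x ^ 2 ≤ 1 - x ^ 2 := by
  have key : ∀ y ∈ Ico (0 : ℝ) 1, u y ^ 2 ≤ 1 - y ^ 2 := fun y hy => by
    have h := hp.antitoneOn_sq_div hu h0 h1 (by norm_num : (0 : ℝ) ∈ Ico (0 : ℝ) 1) hy hy.1
    have hy2 : 0 < 1 - y ^ 2 := by nlinarith [hy.1, hy.2]
    simp only [h0] at h
    rw [div_le_iff₀ hy2] at h
    norm_num at h
    exact h
  rcases le_total 0 x with h | h
  · exact key x ⟨h, hx.2⟩
  · have := key (-x) ⟨by linarith, by linarith [hx.1]⟩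
    rwa [neg_sq, hp.1.solution_even hu h1 hx] at this

/-- Since `F' ≥ 1 / (1 - x²)`, differences of `F` dominate hyperbolic lengths. -/
theorem IsExtremalNehari.artanh_sub_le {p u : ℝ → ℝ} (hp : IsExtremalNehari p)
    (hu : IsSolution p u) (h0 : u 0 = 1) (h1 : deriv u 0 = 0) {x y : ℝ}
    (hx : x ∈ Ioo (-1 : ℝ) 1) (hy : y ∈ Ioo (-1 : ℝ) 1) (hxy : x ≤ y) :
    Real.artanh y - Real.artanh x ≤ extremalF u y - extremalF u x := by
  have hpos : ∀ z ∈ Ioo (-1 : ℝ) 1, 0 < u z := fun z hz => hp.1.solution_pos hu h0 h1 hz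
  have hd : ∀ z ∈ Ioo (-1 : ℝ) 1, HasDerivAt (fun z => extremalF u z - Real.artanh z)
      (1 / u z ^ 2 - 1 / (1 - z ^ 2)) z := fun z hz =>
    (hasDerivAt_extremalF (fun t ht => (hu t ht).1.continuousAt.continuousWithinAt) hpos hz).sub
      (hasDerivAt_artanh hz)
  have hmono : MonotoneOn (fun z => extremalF u z - Real.artanh z) (Ioo (-1 : ℝ) 1) := by
    refine monotoneOn_of_deriv_nonneg (convex_Ioo _ _)
      (fun z hz => (hd z hz).continuousAt.continuousWithinAt)
      (fun z hz => (hd z (interior_subset hz)).differentiableAt.differentiableWithinAt)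
      fun z hz => ?_
    have hz' := interior_subset hz
    rw [(hd z hz').deriv, sub_nonneg]
    exact one_div_le_one_div_of_le (pow_pos (hpos z hz') 2) (hp.sq_le hu h0 h1 hz')
  have := hmono hx hy hxy
  simp only at this
  linarith

/-! ### Spinors of a harmonic mapping -/

theorem isOpen_disk : IsOpen disk := Metric.isOpen_ball

theorem exists_analyticAt_sq_eq {k : ℂ → ℂ} {z : ℂ} (hk : AnalyticAt ℂ k z) (h0 : k z ≠ 0) :
    ∃ a : ℂ → ℂ, AnalyticAt ℂ a z ∧ ∀ᶠ w in 𝓝 z, a w ^ 2 = k w := by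
  obtain ⟨c, hc⟩ := IsAlgClosed.exists_pow_nat_eq (k z) two_pos
  refine ⟨fun w => c * Complex.exp (Complex.log (k w / k z) / 2), ?_, ?_⟩
  · have h1 : AnalyticAt ℂ (fun w => k w / k z) z := hk.div analyticAt_const h0
    have h2 : AnalyticAt ℂ (fun w => Complex.log (k w / k z)) z :=
      h1.clog (by rw [div_self h0]; exact Complex.one_mem_slitPlane)
    exact analyticAt_const.mul (h2.div analyticAt_const two_ne_zero).cexp
  · filter_upwards [hk.continuousAt.eventually_ne h0] with w hw
    rw [mul_pow, hc, ← Complex.exp_nat_mul, Nat.cast_two, mul_div_cancel₀ _ two_ne_zero,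
      Complex.exp_log (div_ne_zero hw h0), mul_div_cancel₀ _ h0]

/-- `h' q` extends holomorphically: it is meromorphic and its square agrees with `h' g'`. -/
theorem IsLiftable.exists_root {f h g q : ℂ → ℂ} (hf : IsLiftable f h g q) :
    ∃ r : ℂ → ℂ, AnalyticOnNhd ℂ r disk ∧ (∀ z ∈ disk, r z ^ 2 = deriv h z * deriv g z) ∧
      ∀ z ∈ disk, ∀ᶠ w in 𝓝[≠] z, deriv h w * q w = r w := by
  have hh' : AnalyticOnNhd ℂ (deriv h) disk := (hf.analytic_h.analyticOnNhd isOpen_disk).deriv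
  have hg' : AnalyticOnNhd ℂ (deriv g) disk := (hf.analytic_g.analyticOnNhd isOpen_disk).deriv
  have hm : MeromorphicOn (fun w => deriv h w * q w) disk :=
    fun z hz => (hh' z hz).meromorphicAt.mul (hf.meromorphic z hz)
  set r := toMeromorphicNFOn (fun w => deriv h w * q w) disk with hr
  have heq : ∀ z ∈ disk, ∀ᶠ w in 𝓝[≠] z, deriv h w * q w = r w := fun z hz =>
    (hm.toMeromorphicNFOn_eq_self_on_nhdsNE hz).mono fun w hw => hw.symm
  have hsq : ∀ z ∈ disk, ∀ᶠ w in 𝓝[≠] z, r w ^ 2 = deriv h w * deriv g w := by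
    intro z hz
    filter_upwards [heq z hz, hf.dilatation z hz] with w h1 h2
    rw [← h1, mul_pow, ← h2.2, pow_two]
    field_simp [h2.1]
  have han : AnalyticOnNhd ℂ r disk := by
    intro z hz
    have hnf : MeromorphicNFAt r z := meromorphicNFOn_toMeromorphicNFOn _ _ hz
    rw [← hnf.meromorphicOrderAt_nonneg_iff_analyticAt]
    have h1 : meromorphicOrderAt (r ^ 2) z =
        meromorphicOrderAt (fun w => deriv h w * deriv g w) z :=
      meromorphicOrderAt_congr (hsq z hz)
    have h2 : 0 ≤ meromorphicOrderAt (r ^ 2) z := by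
      rw [h1]
      exact ((hh' z hz).mul (hg' z hz)).meromorphicOrderAt_nonneg
    rw [meromorphicOrderAt_pow hnf.meromorphicAt] at h2
    by_contra hneg
    rw [not_le] at hneg
    have hne : meromorphicOrderAt r z ≠ ⊤ := hneg.ne_top
    lift meromorphicOrderAt r z to ℤ using hne with n
    have h3 : ((0 : ℤ) : WithTop ℤ) ≤ ((2 * n : ℤ) : WithTop ℤ) := by
      rw [WithTop.coe_mul]
      exact h2
    rw [WithTop.coe_le_coe] at h3
    have h4 : n < 0 := by exact_mod_cast hneg
    omega
  refine ⟨r, han, fun z hz => ?_, heq⟩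
  have h1 : ContinuousAt (fun w => r w ^ 2) z := (han z hz).continuousAt.pow 2
  have h2 : ContinuousAt (fun w => deriv h w * deriv g w) z :=
    ((hh' z hz).mul (hg' z hz)).continuousAt
  exact ((ContinuousAt.eventuallyEq_nhds_iff_eventuallyEq_nhdsNE h1 h2).1 (hsq z hz)).eq_of_nhds

/-- Local spinors: near each point `h' = a²`, `g' = b²` and `h' q = a b`, with `a`, `b`
holomorphic. -/
theorem IsLiftable.exists_spinor {f h g q r : ℂ → ℂ} (hf : IsLiftable f h g q)
    (hr : AnalyticOnNhd ℂ r disk) (hr2 : ∀ z ∈ disk, r z ^ 2 = deriv h z * deriv g z) {z : ℂ}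
    (hz : z ∈ disk) : ∃ a b : ℂ → ℂ, AnalyticAt ℂ a z ∧ AnalyticAt ℂ b z ∧ (a z ≠ 0 ∨ b z ≠ 0) ∧
      ∀ᶠ w in 𝓝 z, deriv h w = a w ^ 2 ∧ deriv g w = b w ^ 2 ∧ r w = a w * b w := by
  have hh' : AnalyticAt ℂ (deriv h) z := (hf.analytic_h.analyticOnNhd isOpen_disk).deriv z hz
  have hg' : AnalyticAt ℂ (deriv g) z := (hf.analytic_g.analyticOnNhd isOpen_disk).deriv z hz
  by_cases h0 : deriv h z = 0
  · have h1 : deriv g z ≠ 0 := fun h1 => hf.nonvanishing z hz (by rw [h0, h1]; simp)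
    obtain ⟨b, hb, hb2⟩ := exists_analyticAt_sq_eq hg' h1
    have hbz : b z ≠ 0 := fun hb0 => h1 (by rw [← hb2.self_of_nhds, hb0]; simp)
    refine ⟨fun w => r w / b w, b, (hr z hz).div hb hbz, hb, Or.inr hbz, ?_⟩
    filter_upwards [hb2, isOpen_disk.mem_nhds hz, hb.continuousAt.eventually_ne hbz] with w e1 e2 e3
    refine ⟨?_, e1.symm, (div_mul_cancel₀ _ e3).symm⟩
    rw [div_pow, hr2 w e2, ← e1, mul_div_cancel_right₀ _ (pow_ne_zero 2 e3)]
  · obtain ⟨a, ha, ha2⟩ := exists_analyticAt_sq_eq hh' h0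
    have haz : a z ≠ 0 := fun ha0 => h0 (by rw [← ha2.self_of_nhds, ha0]; simp)
    refine ⟨a, fun w => r w / a w, ha, (hr z hz).div ha haz, Or.inl haz, ?_⟩
    filter_upwards [ha2, isOpen_disk.mem_nhds hz, ha.continuousAt.eventually_ne haz] with w e1 e2 e3
    refine ⟨e1.symm, ?_, (mul_div_cancel₀ _ e3).symm⟩
    rw [div_pow, hr2 w e2, ← e1, mul_div_cancel_left₀ _ (pow_ne_zero 2 e3)]

/-- The third coordinate of the lift is the imaginary part of twice the primitive of `h' q`; the
poles of `q` do not affect the integral because they are isolated on the segment. -/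
theorem lift_eq {f h g q r H : ℂ → ℂ} (hf : IsLiftable f h g q) (hr : AnalyticOnNhd ℂ r disk)
    (heq : ∀ z ∈ disk, ∀ᶠ w in 𝓝[≠] z, deriv h w * q w = r w) (hH0 : H 0 = 0)
    (hH : ∀ z ∈ disk, HasDerivAt H (r z) z) {z : ℂ} (hz : z ∈ disk) :
    lift f h q z = !₂[(h z + g z).re, (h z - g z).im, 2 * (H z).im] := by
  have hmem : ∀ t ∈ Icc (0 : ℝ) 1, (t : ℂ) * z ∈ disk := by
    intro t ht
    rw [disk, mem_ball_zero_iff] at hz ⊢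
    rw [norm_mul, Complex.norm_real, Real.norm_of_nonneg ht.1]
    nlinarith [norm_nonneg z, ht.2]
  have hd : ∀ t : ℝ, HasDerivAt (fun s : ℝ => (s : ℂ) * z) z t := fun t => by
    simpa using (hasDerivAt_id t).ofReal_comp.mul_const z
  have h1 : ∫ t in (0 : ℝ)..1, deriv h ((t : ℂ) * z) * q ((t : ℂ) * z) * z =
      ∫ t in (0 : ℝ)..1, r ((t : ℂ) * z) * z := by
    rcases eq_or_ne z 0 with rfl | hz0
    · simp
    refine intervalIntegral.integral_congr_ae_restrict
      (ae_restrict_le_codiscreteWithin measurableSet_uIoc ?_)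
    refine mem_codiscreteWithin_iff_forall_mem_nhdsNE.2 fun t ht => ?_
    rw [uIoc_of_le zero_le_one] at ht
    have htend : Tendsto (fun s : ℝ => (s : ℂ) * z) (𝓝[≠] t) (𝓝[≠] ((t : ℂ) * z)) :=
      tendsto_nhdsWithin_of_tendsto_nhds_of_eventually_within _
        ((hd t).continuousAt.tendsto.mono_left nhdsWithin_le_nhds)
        (eventually_nhdsWithin_of_forall fun s hs hst =>
          hs (Complex.ofReal_injective (mul_right_cancel₀ hz0 hst)))
    filter_upwards [htend.eventually (heq _ (hmem t ⟨ht.1.le, ht.2⟩))] with s hs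
    exact Or.inl (by simp only [mem_ofPred_eq, hs])
  have h2 : ∫ t in (0 : ℝ)..1, r ((t : ℂ) * z) * z = H z := by
    have h3 : ∀ t ∈ uIcc (0 : ℝ) 1,
        HasDerivAt (fun s : ℝ => H ((s : ℂ) * z)) (r ((t : ℂ) * z) * z) t := by
      intro t ht
      rw [uIcc_of_le zero_le_one] at ht
      exact (hH _ (hmem t ht)).comp t (hd t)
    have h4 : ContinuousOn (fun t : ℝ => r ((t : ℂ) * z) * z) (uIcc 0 1) := by
      intro t ht
      rw [uIcc_of_le zero_le_one] at ht
      have h5 : ContinuousAt (fun s : ℝ => r ((s : ℂ) * z)) t :=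
        ContinuousAt.comp (f := fun s : ℝ => (s : ℂ) * z) (hr _ (hmem t ht)).continuousAt
          (hd t).continuousAt
      exact (h5.mul continuousAt_const).continuousWithinAt
    rw [intervalIntegral.integral_eq_sub_of_hasDerivAt h3 h4.intervalIntegrable]
    simp [hH0]
  rw [lift, h1, h2, hf.decomposition z hz]
  simp [sub_eq_add_neg]

theorem spinorNormSq_mul (s a b : ℂ) :
    spinorNormSq (s * a) (s * b) = Complex.normSq s * spinorNormSq a b := by
  simp [spinorNormSq, mul_add]

/-- The transformation rule of the Schwarzian under a Möbius change of variable `T` with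
`T' = s²`, for which `s' = κ s` and `s'' = 2 κ² s`. -/
theorem spinorSchwarzian_mul {s κ a b a₁ b₁ a₂ b₂ : ℂ} (hs : s ≠ 0) (h0 : a ≠ 0 ∨ b ≠ 0) :
    spinorSchwarzian (s * a) (s * b) (κ * s * a + s ^ 3 * a₁) (κ * s * b + s ^ 3 * b₁)
      (2 * κ ^ 2 * s * a + 4 * κ * s ^ 3 * a₁ + s ^ 5 * a₂)
      (2 * κ ^ 2 * s * b + 4 * κ * s ^ 3 * b₁ + s ^ 5 * b₂) =
      s ^ 4 * spinorSchwarzian a b a₁ b₁ a₂ b₂ := by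
  have hl : (spinorNormSq a b : ℂ) ≠ 0 := by exact_mod_cast (spinorNormSq_pos h0).ne'
  have hs' : conj s ≠ 0 := (map_ne_zero _).2 hs
  have h1 : ((κ * s * a + s ^ 3 * a₁) * conj (s * a) + (κ * s * b + s ^ 3 * b₁) * conj (s * b)) /
      spinorNormSq (s * a) (s * b) =
      κ + s ^ 2 * ((a₁ * conj a + b₁ * conj b) / spinorNormSq a b) := by
    rw [spinorNormSq_mul, Complex.ofReal_mul, ← Complex.mul_conj, map_mul, map_mul]
    field_simp
    rw [ofReal_spinorNormSq]
    ring
  have h2 : ((2 * κ ^ 2 * s * a + 4 * κ * s ^ 3 * a₁ + s ^ 5 * a₂) * conj (s * a) +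
      (2 * κ ^ 2 * s * b + 4 * κ * s ^ 3 * b₁ + s ^ 5 * b₂) * conj (s * b)) /
      spinorNormSq (s * a) (s * b) =
      2 * κ ^ 2 + 4 * κ * s ^ 2 * ((a₁ * conj a + b₁ * conj b) / spinorNormSq a b) +
        s ^ 4 * ((a₂ * conj a + b₂ * conj b) / spinorNormSq a b) := by
    rw [spinorNormSq_mul, Complex.ofReal_mul, ← Complex.mul_conj, map_mul, map_mul]
    field_simp
    rw [ofReal_spinorNormSq]
    ring
  rw [spinorSchwarzian, spinorSchwarzian, h1, h2]
  ring

theorem norm_spinorWronskian_mul {s κ a b a₁ b₁ : ℂ} (hs : s ≠ 0) (h0 : a ≠ 0 ∨ b ≠ 0) :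
    ‖spinorWronskian (s * a) (s * b) (κ * s * a + s ^ 3 * a₁) (κ * s * b + s ^ 3 * b₁)‖ =
      ‖s‖ ^ 2 * ‖spinorWronskian a b a₁ b₁‖ := by
  have hs' : ‖s‖ ≠ 0 := norm_ne_zero_iff.2 hs
  have hl := spinorNormSq_pos h0
  have h1 : s * a * (κ * s * b + s ^ 3 * b₁) - (κ * s * a + s ^ 3 * a₁) * (s * b) =
      s ^ 4 * (a * b₁ - a₁ * b) := by ring
  rw [spinorWronskian, spinorWronskian, h1, spinorNormSq_mul, norm_div, norm_div, norm_mul,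
    norm_pow, Complex.norm_real, Complex.norm_real, Real.norm_of_nonneg hl.le, norm_mul,
    Real.norm_of_nonneg hl.le, Complex.normSq_eq_norm_sq, norm_pow, norm_norm]
  field_simp

/-! ### The lift along a geodesic -/

theorem eventually_hasDerivAt_comp_ofReal {F F' : ℂ → ℂ} {x : ℝ}
    (h : ∀ᶠ ζ in 𝓝 (x : ℂ), HasDerivAt F (F' ζ) ζ) :
    ∀ᶠ y : ℝ in 𝓝 x, HasDerivAt (fun s : ℝ => F s) (F' y) y :=
  (Complex.continuous_ofReal.continuousAt.eventually h).mono fun _ hy => hy.comp_ofReal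

/-- A square root of the derivative of `geodesicMap (μ ^ 2) t`. -/
def geodesicRoot (μ : ℂ) (t : ℝ) (ζ : ℂ) : ℂ := μ * √(1 - t ^ 2) / (1 - Complex.I * t * ζ)

theorem geodesicRoot_sq (μ : ℂ) {t : ℝ} (ht : |t| < 1) (ζ : ℂ) :
    geodesicRoot μ t ζ ^ 2 = μ ^ 2 * ((1 - t ^ 2) / (1 - Complex.I * t * ζ) ^ 2) := by
  have ht2 : 0 ≤ 1 - t ^ 2 := by
    have := (sq_lt_one_iff_abs_lt_one t).2 ht
    linarith
  have h : ((√(1 - t ^ 2) : ℝ) : ℂ) ^ 2 = 1 - (t : ℂ) ^ 2 := by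
    rw [← Complex.ofReal_pow, Real.sq_sqrt ht2]
    push_cast
    rfl
  rw [geodesicRoot, div_pow, mul_pow, h, mul_div_assoc]

theorem geodesicRoot_ne_zero {μ : ℂ} (hμ : μ ≠ 0) {t : ℝ} (ht : |t| < 1) (x : ℝ) :
    geodesicRoot μ t x ≠ 0 := by
  have ht2 : 0 < 1 - t ^ 2 := by
    have := (sq_lt_one_iff_abs_lt_one t).2 ht
    linarith
  exact div_ne_zero (mul_ne_zero hμ (by exact_mod_cast (Real.sqrt_pos.2 ht2).ne'))
    (one_sub_I_mul_ne_zero t x)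

/-- The logarithmic derivative of `geodesicRoot`. -/
def geodesicRootLogDeriv (t : ℝ) (ζ : ℂ) : ℂ := Complex.I * t / (1 - Complex.I * t * ζ)

theorem hasDerivAt_geodesicRoot (μ : ℂ) (t : ℝ) {ζ : ℂ} (h : 1 - Complex.I * t * ζ ≠ 0) :
    HasDerivAt (geodesicRoot μ t) (geodesicRootLogDeriv t ζ * geodesicRoot μ t ζ) ζ := by
  have h1 := (hasDerivAt_const ζ (μ * √(1 - t ^ 2))).div
    (((hasDerivAt_id ζ).const_mul (Complex.I * t)).const_sub 1) h
  refine h1.congr_deriv ?_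
  simp only [geodesicRoot, geodesicRootLogDeriv, id]
  field_simp
  ring

theorem hasDerivAt_geodesicRootLogDeriv (t : ℝ) {ζ : ℂ} (h : 1 - Complex.I * t * ζ ≠ 0) :
    HasDerivAt (geodesicRootLogDeriv t) (geodesicRootLogDeriv t ζ ^ 2) ζ := by
  have h1 := (hasDerivAt_const ζ (Complex.I * t)).div
    (((hasDerivAt_id ζ).const_mul (Complex.I * t)).const_sub 1) h
  refine h1.congr_deriv ?_
  simp only [geodesicRootLogDeriv, id]
  field_simp
  ring

/-- The pull-back `ζ ↦ s(ζ) a(T ζ)` of a spinor component by `T = geodesicMap (μ ^ 2) t`, with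
`s = geodesicRoot μ t`, and its first two derivatives. -/
theorem hasDerivAt_spinor_pullback {μ : ℂ} {t x : ℝ} (ht : |t| < 1) {a : ℂ → ℂ}
    (ha : AnalyticAt ℂ a (geodesicMap (μ ^ 2) t x)) :
    (∀ᶠ ζ in 𝓝 (x : ℂ), HasDerivAt (fun ζ => geodesicRoot μ t ζ * a (geodesicMap (μ ^ 2) t ζ))
      (geodesicRootLogDeriv t ζ * geodesicRoot μ t ζ * a (geodesicMap (μ ^ 2) t ζ) +
        geodesicRoot μ t ζ ^ 3 * deriv a (geodesicMap (μ ^ 2) t ζ)) ζ) ∧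
    HasDerivAt (fun ζ => geodesicRootLogDeriv t ζ * geodesicRoot μ t ζ *
        a (geodesicMap (μ ^ 2) t ζ) +
        geodesicRoot μ t ζ ^ 3 * deriv a (geodesicMap (μ ^ 2) t ζ))
      (2 * geodesicRootLogDeriv t x ^ 2 * geodesicRoot μ t x * a (geodesicMap (μ ^ 2) t x) +
        4 * geodesicRootLogDeriv t x * geodesicRoot μ t x ^ 3 *
          deriv a (geodesicMap (μ ^ 2) t x) +
        geodesicRoot μ t x ^ 5 * deriv (deriv a) (geodesicMap (μ ^ 2) t x)) x := by
  have hx := one_sub_I_mul_ne_zero t x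
  have hT : ∀ ζ, 1 - Complex.I * t * ζ ≠ 0 →
      HasDerivAt (geodesicMap (μ ^ 2) t) (geodesicRoot μ t ζ ^ 2) ζ := fun ζ hζ => by
    rw [geodesicRoot_sq μ ht]
    exact hasDerivAt_geodesicMap _ t hζ
  constructor
  · have h1 : ∀ᶠ ζ : ℂ in 𝓝 (x : ℂ), 1 - Complex.I * t * ζ ≠ 0 :=
      ContinuousAt.eventually_ne (by fun_prop) hx
    filter_upwards [h1, (hT _ hx).continuousAt.eventually ha.eventually_analyticAt] with ζ h2 h3
    refine ((hasDerivAt_geodesicRoot μ t h2).mul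
      (h3.differentiableAt.hasDerivAt.comp ζ (hT ζ h2))).congr_deriv ?_
    simp only [Function.comp_apply]
    ring
  · have h1 := (((hasDerivAt_geodesicRootLogDeriv t hx).mul (hasDerivAt_geodesicRoot μ t hx)).mul
      (ha.differentiableAt.hasDerivAt.comp (x : ℂ) (hT _ hx))).add
      (((hasDerivAt_geodesicRoot μ t hx).pow 3).mul
        (ha.deriv.differentiableAt.hasDerivAt.comp (x : ℂ) (hT _ hx)))
    refine h1.congr_deriv ?_
    simp only [Function.comp_apply, Pi.mul_apply, Pi.pow_apply]
    push_cast
    ring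

/-- The weighted monotonicity of `p` makes the bound `2 p(|z|)` inherited, along a geodesic
`T = geodesicMap ω t`, by the pull-back under `T`. -/
theorem IsNehari.weight_geodesicMap_le {p : ℝ → ℝ} (hp : IsNehari p) {ω : ℂ} (hω : ‖ω‖ = 1)
    {t x : ℝ} (ht : |t| < 1) (hx : x ∈ Ioo (-1 : ℝ) 1) :
    ((1 - ‖geodesicMap ω t x‖ ^ 2) / (1 - x ^ 2)) ^ 2 * p ‖geodesicMap ω t x‖ ≤ p x := by
  have h1 := geodesicMap_mem_disk hω ht hx
  rw [disk, mem_ball_zero_iff] at h1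
  have h := hp.antitoneOn ⟨abs_nonneg x, abs_lt.2 hx⟩ ⟨norm_nonneg _, h1⟩
    (abs_le_norm_geodesicMap hω hx)
  have hpx : p |x| = p x := by
    rcases abs_choice x with h | h <;> rw [h]
    exact hp.even x hx
  simp only [sq_abs, hpx] at h
  have hx2 := one_sub_sq_pos hx
  rw [div_pow, div_mul_eq_mul_div, div_le_iff₀ (by positivity)]
  linarith

/-- The lift of `f`, restricted to the geodesic parametrised by `geodesicMap (μ ^ 2) t`, is a curve
whose Ahlfors Schwarzian is at most `2 p`. -/
theorem IsLiftable.schwarzianLE {f h g q r H : ℂ → ℂ} (hf : IsLiftable f h g q)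
    (hr : AnalyticOnNhd ℂ r disk) (hr2 : ∀ z ∈ disk, r z ^ 2 = deriv h z * deriv g z)
    (hH : ∀ z ∈ disk, HasDerivAt H (r z) z) {p : ℝ → ℝ} (hp : IsNehari p)
    (hS : ∀ z ∈ disk, ‖schwarzian h g z‖ + conformalFactor h g z ^ 2 * |gaussCurvature h g z| ≤
      2 * p ‖z‖) {μ : ℂ} (hμ : ‖μ ^ 2‖ = 1) {t : ℝ} (ht : |t| < 1) :
    ∃ ψ ψ' : ℝ → EuclideanSpace ℝ (Fin 3), ∃ τ τ₁ τ₂ : ℝ → ℝ,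
      SchwarzianLE p (fun x : ℝ => !₂[(h (geodesicMap (μ ^ 2) t x) +
          g (geodesicMap (μ ^ 2) t x)).re, (h (geodesicMap (μ ^ 2) t x) -
          g (geodesicMap (μ ^ 2) t x)).im, 2 * (H (geodesicMap (μ ^ 2) t x)).im])
        ψ ψ' τ τ₁ τ₂ ∧
      ∀ x ∈ Ioo (-1 : ℝ) 1, Real.exp (τ x) = conformalFactor h g (geodesicMap (μ ^ 2) t x) *
        ((1 - ‖geodesicMap (μ ^ 2) t x‖ ^ 2) / (1 - x ^ 2)) := by
  have hμ0 : μ ≠ 0 := by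
    rintro rfl
    norm_num at hμ
  set T : ℂ → ℂ := geodesicMap (μ ^ 2) t with hT_def
  set s : ℂ → ℂ := geodesicRoot μ t with hs_def
  have hTd : ∀ x : ℝ, HasDerivAt T (s x ^ 2) x := fun x => by
    rw [hs_def, geodesicRoot_sq μ ht]
    exact hasDerivAt_geodesicMap _ t (one_sub_I_mul_ne_zero t x)
  have hTR : ∀ x : ℝ, HasDerivAt (fun y : ℝ => T y) (s x ^ 2) x := fun x => (hTd x).comp_ofReal
  have hTmem : ∀ x ∈ Ioo (-1 : ℝ) 1, T x ∈ disk := fun x hx => geodesicMap_mem_disk hμ ht hx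
  have hsn : ∀ x ∈ Ioo (-1 : ℝ) 1, ‖s x‖ ^ 2 = (1 - ‖T x‖ ^ 2) / (1 - x ^ 2) := fun x hx => by
    rw [← norm_pow, hs_def, geodesicRoot_sq μ ht]
    exact norm_deriv_geodesicMap hμ ht hx
  set τ : ℝ → ℝ := fun x => Real.log (‖s x‖ ^ 2 * conformalFactor h g (T x)) with hτ_def
  set ψ : ℝ → EuclideanSpace ℝ (Fin 3) := fun x =>
    !₂[((deriv h (T x) + deriv g (T x)) * s x ^ 2).re,
    ((deriv h (T x) - deriv g (T x)) * s x ^ 2).im, 2 * (r (T x) * s x ^ 2).im] with hψ_def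
  have key : ∀ x ∈ Ioo (-1 : ℝ) 1, DifferentiableAt ℝ τ x ∧ DifferentiableAt ℝ (deriv τ) x ∧
      DifferentiableAt ℝ ψ x ∧ ‖ψ x‖ = Real.exp (τ x) ∧ deriv (deriv τ) x - deriv τ x ^ 2 / 2 +
      ‖deriv ψ x - deriv τ x • ψ x‖ ^ 2 / (2 * Real.exp (τ x) ^ 2) ≤ 2 * p x := by
    intro x hx
    obtain ⟨a, b, ha, hb, h0, hab⟩ := hf.exists_spinor hr hr2 (hTmem x hx)
    have hsx : s x ≠ 0 := geodesicRoot_ne_zero hμ0 ht x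
    obtain ⟨hA, hA₁⟩ := hasDerivAt_spinor_pullback (μ := μ) ht ha
    obtain ⟨hB, hB₁⟩ := hasDerivAt_spinor_pullback (μ := μ) ht hb
    have habR : ∀ᶠ y : ℝ in 𝓝 x, deriv h (T y) = a (T y) ^ 2 ∧ deriv g (T y) = b (T y) ^ 2 ∧
        r (T y) = a (T y) * b (T y) := (hTR x).continuousAt.eventually hab
    have hnorm : ∀ c d : ℂ, ‖c ^ 2‖ + ‖d ^ 2‖ = spinorNormSq c d := fun c d => by
      rw [spinorNormSq, Complex.normSq_eq_norm_sq, Complex.normSq_eq_norm_sq, norm_pow, norm_pow]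
    have hτ : τ =ᶠ[𝓝 x] fun y => Real.log (spinorNormSq (s y * a (T y)) (s y * b (T y))) := by
      filter_upwards [habR] with y hy
      rw [hτ_def, spinorNormSq_mul, Complex.normSq_eq_norm_sq]
      simp only [conformalFactor]
      rw [hy.1, hy.2.1, hnorm]
    have hψ : ψ =ᶠ[𝓝 x] fun y => spinorVec (s y * a (T y)) (s y * b (T y)) := by
      filter_upwards [habR] with y hy
      simp only [hψ_def, spinorVec]
      rw [hy.1, hy.2.1, hy.2.2, add_mul, sub_mul, mul_mul_mul_comm, ← pow_two (s y),
        mul_comm (s y ^ 2), mul_pow, mul_pow, mul_comm (s y ^ 2), mul_comm (s y ^ 2)]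
    have h0' : s x * a (T x) ≠ 0 ∨ s x * b (T x) ≠ 0 :=
      h0.imp (mul_ne_zero hsx) (mul_ne_zero hsx)
    obtain ⟨c1, c2, c3, c4, c5⟩ := spinor_curve (eventually_hasDerivAt_comp_ofReal hA)
      (eventually_hasDerivAt_comp_ofReal hB) hA₁.comp_ofReal hB₁.comp_ofReal h0' hτ hψ
    refine ⟨c1, c2, c3, c4, c5.trans ?_⟩
    have hjet : ∀ {k : ℂ → ℂ}, AnalyticAt ℂ k (T x) →
        (∀ᶠ w in 𝓝 (T x), HasDerivAt k (deriv k w) w) ∧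
        HasDerivAt (deriv k) (deriv (deriv k) (T x)) (T x) := fun hk =>
      ⟨hk.eventually_analyticAt.mono fun w hw => hw.differentiableAt.hasDerivAt,
        hk.deriv.differentiableAt.hasDerivAt⟩
    obtain ⟨e1, e2⟩ := schwarzian_gaussCurvature_eq (h := h) (g := g) (hjet ha).1 (hjet hb).1
      (hjet ha).2 (hjet hb).2 h0
      (hab.mono fun w hw => by rw [conformalFactor, hw.1, hw.2.1, hnorm])
    have hbound := hS _ (hTmem x hx)
    rw [e1, e2] at hbound
    rw [spinorSchwarzian_mul hsx h0, norm_spinorWronskian_mul hsx h0, norm_mul, norm_pow]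
    calc _ = (‖s x‖ ^ 2) ^ 2 * (‖spinorSchwarzian (a (T x)) (b (T x)) (deriv a (T x))
          (deriv b (T x)) (deriv (deriv a) (T x)) (deriv (deriv b) (T x))‖ +
          4 * ‖spinorWronskian (a (T x)) (b (T x)) (deriv a (T x)) (deriv b (T x))‖ ^ 2) := by
          ring
      _ ≤ (‖s x‖ ^ 2) ^ 2 * (2 * p ‖T x‖) := mul_le_mul_of_nonneg_left hbound (by positivity)
      _ = 2 * ((‖s x‖ ^ 2) ^ 2 * p ‖T x‖) := by ring
      _ ≤ 2 * p x := by
          rw [hsn x hx]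
          exact mul_le_mul_of_nonneg_left (hp.weight_geodesicMap_le hμ ht hx) two_pos.le
  refine ⟨ψ, deriv ψ, τ, deriv τ, deriv (deriv τ), ⟨fun x hx => ?_, fun x hx => ?_, fun x hx => ?_,
    fun x hx => ?_, fun x hx => ?_, fun x hx => ?_⟩, fun x hx => ?_⟩
  · have hh := (hf.analytic_h.differentiableAt (isOpen_disk.mem_nhds (hTmem x hx))).hasDerivAt
    have hg := (hf.analytic_g.differentiableAt (isOpen_disk.mem_nhds (hTmem x hx))).hasDerivAt
    have h1 := hh.comp x (hTR x)
    have h2 := hg.comp x (hTR x)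
    have h3 := (hH _ (hTmem x hx)).comp x (hTR x)
    refine hasDerivAt_euclidean_three ?_ ?_ ?_
    · exact (hasDerivAt_re (h1.add h2)).congr_deriv (by rw [add_mul])
    · exact (hasDerivAt_im (h1.sub h2)).congr_deriv (by rw [sub_mul])
    · exact (hasDerivAt_im h3).const_mul 2
  · exact (key x hx).2.2.1.hasDerivAt
  · exact (key x hx).1.hasDerivAt
  · exact (key x hx).2.1.hasDerivAt
  · exact (key x hx).2.2.2.1
  · exact (key x hx).2.2.2.2
  · have hl : 0 < conformalFactor h g (T x) :=
      lt_of_le_of_ne (add_nonneg (norm_nonneg _) (norm_nonneg _))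
        (hf.nonvanishing _ (hTmem x hx)).symm
    have hsx : 0 < ‖s x‖ := norm_pos_iff.2 (geodesicRoot_ne_zero hμ0 ht x)
    rw [hτ_def]
    simp only
    rw [Real.exp_log (by positivity), hsn x hx, mul_comm]

/-- The comparison of the weights at `x` and at its image: `(1 - x²) F'(x)` increases with `|x|`,
and the image is farther from the origin. -/
theorem IsExtremalNehari.mul_sq_le {p u : ℝ → ℝ} (hp : IsExtremalNehari p) (hu : IsSolution p u)
    (h0 : u 0 = 1) (h1 : deriv u 0 = 0) {ω : ℂ} (hω : ‖ω‖ = 1) {t x : ℝ} (ht : |t| < 1)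
    (hx : x ∈ Ioo (-1 : ℝ) 1) : u ‖geodesicMap ω t x‖ ^ 2 ≤
      (1 - ‖geodesicMap ω t x‖ ^ 2) / (1 - x ^ 2) * u x ^ 2 := by
  have hm := geodesicMap_mem_disk hω ht hx
  rw [disk, mem_ball_zero_iff] at hm
  have h := hp.antitoneOn_sq_div hu h0 h1 ⟨abs_nonneg x, abs_lt.2 hx⟩ ⟨norm_nonneg _, hm⟩
    (abs_le_norm_geodesicMap hω hx)
  have hux : u |x| = u x := by
    rcases abs_choice x with h | h <;> rw [h]
    exact hp.1.solution_even hu h1 hx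
  have hm2 : 0 < 1 - ‖geodesicMap ω t x‖ ^ 2 := by nlinarith [norm_nonneg (geodesicMap ω t x)]
  simp only [sq_abs, hux] at h
  rw [div_le_iff₀ hm2] at h
  refine h.trans_eq ?_
  ring

end HarmonicLift

end

theorem theorem3 (f h g q : ℂ → ℂ) (hf : HarmonicLift.IsLiftable f h g q)
    (p : ℝ → ℝ) (hp : HarmonicLift.IsExtremalNehari p)
    (hS : ∀ z ∈ HarmonicLift.disk,
      ‖HarmonicLift.schwarzian h g z‖ +
        HarmonicLift.conformalFactor h g z ^ 2 * |HarmonicLift.gaussCurvature h g z| ≤ 2 * p ‖z‖)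
    (u₀ : ℝ → ℝ) (hu₀ : HarmonicLift.IsSolution p u₀) (hu₀_zero : u₀ 0 = 1)
    (hu₀_deriv : deriv u₀ 0 = 0) :
    ∀ z₁ ∈ HarmonicLift.disk, ∀ z₂ ∈ HarmonicLift.disk,
      Real.sqrt (HarmonicLift.conformalFactor h g z₁ * HarmonicLift.conformalFactor h g z₂ /
          (deriv (HarmonicLift.extremalF u₀) ‖z₁‖ * deriv (HarmonicLift.extremalF u₀) ‖z₂‖)) *
        HarmonicLift.hypDist z₁ z₂ ≤
      ‖HarmonicLift.lift f h q z₁ - HarmonicLift.lift f h q z₂‖ := by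
  open HarmonicLift Set in
  intro z₁ hz₁ z₂ hz₂
  have hpos : ∀ x ∈ Ioo (-1 : ℝ) 1, 0 < u₀ x :=
    fun x hx => hp.1.solution_pos hu₀ hu₀_zero hu₀_deriv hx
  obtain ⟨ω, hω, t, ht, x₁, hx₁, x₂, hx₂, rfl, rfl⟩ := exists_geodesicMap_eq hz₁ hz₂
  obtain ⟨μ, rfl⟩ := IsAlgClosed.exists_pow_nat_eq ω two_pos
  wlog hlt : x₁ < x₂ generalizing x₁ x₂
  · rcases (not_lt.1 hlt).eq_or_lt with rfl | hlt'
    · simp [hypDist_geodesicMap hω ht hx₁ hx₁]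
    · have := this x₂ hx₂ x₁ hx₁ hz₂ hz₁ hlt'
      rw [hypDist_geodesicMap hω ht hx₂ hx₁] at this
      rw [hypDist_geodesicMap hω ht hx₁ hx₂, norm_sub_rev, abs_sub_comm, mul_comm x₁ x₂,
        mul_comm (conformalFactor h g _), mul_comm (deriv (extremalF u₀) _)]
      exact this
  obtain ⟨r, hr, hr2, heq⟩ := hf.exists_root
  obtain ⟨H, hH0, hH⟩ := (hr.differentiableOn.isExactOn_ball (c := 0) (r := 1)).with_val_at 0 0
  obtain ⟨ψ, ψ', τ, τ₁, τ₂, hcurve, hτ⟩ := hf.schwarzianLE hr hr2 hH hp.1 hS hω ht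
  have key := hcurve.le_norm_sub hu₀ hpos hx₁ hx₂ hlt
  simp only [← lift_eq hf hr heq hH0 hH hz₁, ← lift_eq hf hr heq hH0 hH hz₂] at key
  rw [norm_sub_rev]
  refine le_trans ?_ key
  have hu₀c : ContinuousOn u₀ (Ioo (-1 : ℝ) 1) :=
    fun x hx => (hu₀ x hx).1.continuousAt.continuousWithinAt
  have hF : ∀ z ∈ disk, deriv (extremalF u₀) ‖z‖ = 1 / u₀ ‖z‖ ^ 2 ∧ 0 < u₀ ‖z‖ := by
    intro z hz
    rw [disk, mem_ball_zero_iff] at hz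
    have hmem : ‖z‖ ∈ Ioo (-1 : ℝ) 1 := ⟨by linarith [norm_nonneg z], hz⟩
    exact ⟨(hasDerivAt_extremalF hu₀c hpos hmem).deriv, hpos _ hmem⟩
  have hpt : ∀ x ∈ Ioo (-1 : ℝ) 1, conformalFactor h g (geodesicMap (μ ^ 2) t x) *
      u₀ ‖geodesicMap (μ ^ 2) t x‖ ^ 2 ≤ (Real.exp (τ x / 2) * u₀ x) ^ 2 := by
    intro x hx
    have h1 := hp.mul_sq_le hu₀ hu₀_zero hu₀_deriv hω ht hx
    have h2 : Real.exp (τ x / 2) ^ 2 = Real.exp (τ x) := by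
      rw [← Real.exp_nat_mul]
      congr 1
      push_cast
      ring
    rw [mul_pow, h2, hτ x hx, mul_assoc]
    exact mul_le_mul_of_nonneg_left h1 (add_nonneg (norm_nonneg _) (norm_nonneg _))
  have hdist : hypDist (geodesicMap (μ ^ 2) t x₁) (geodesicMap (μ ^ 2) t x₂) ≤
      extremalF u₀ x₂ - extremalF u₀ x₁ := by
    rw [hypDist_geodesicMap hω ht hx₁ hx₂, abs_sub_comm, abs_of_pos (sub_pos.2 hlt),
      artanh_sub hx₁ hx₂]
    exact hp.artanh_sub_le hu₀ hu₀_zero hu₀_deriv hx₁ hx₂ hlt.le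
  have hdist0 : 0 ≤ hypDist (geodesicMap (μ ^ 2) t x₁) (geodesicMap (μ ^ 2) t x₂) :=
    Real.artanh_nonneg (by positivity)
  have hc0 : 0 ≤ Real.exp (τ x₁ / 2) * u₀ x₁ := mul_nonneg (Real.exp_pos _).le (hpos _ hx₁).le
  have hc1 : 0 ≤ Real.exp (τ x₂ / 2) * u₀ x₂ := mul_nonneg (Real.exp_pos _).le (hpos _ hx₂).le
  have hsqrt : Real.sqrt (conformalFactor h g (geodesicMap (μ ^ 2) t x₁) *
      conformalFactor h g (geodesicMap (μ ^ 2) t x₂) /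
      (deriv (extremalF u₀) ‖geodesicMap (μ ^ 2) t x₁‖ *
        deriv (extremalF u₀) ‖geodesicMap (μ ^ 2) t x₂‖)) ≤
      (Real.exp (τ x₁ / 2) * u₀ x₁) * (Real.exp (τ x₂ / 2) * u₀ x₂) := by
    rw [(hF _ hz₁).1, (hF _ hz₂).1]
    refine Real.sqrt_le_iff.2 ⟨mul_nonneg hc0 hc1, ?_⟩
    have h3 := mul_le_mul (hpt x₁ hx₁) (hpt x₂ hx₂)
      (mul_nonneg (add_nonneg (norm_nonneg _) (norm_nonneg _)) (sq_nonneg _)) (sq_nonneg _)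
    have e1 := (hF _ hz₁).2
    have e2 := (hF _ hz₂).2
    rw [mul_pow]
    refine le_trans (le_of_eq ?_) h3
    field_simp
  calc _ ≤ ((Real.exp (τ x₁ / 2) * u₀ x₁) * (Real.exp (τ x₂ / 2) * u₀ x₂)) *
        (extremalF u₀ x₂ - extremalF u₀ x₁) :=
      mul_le_mul hsqrt hdist hdist0 (mul_nonneg hc0 hc1)
    _ = _ := by ring
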